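/- There is an absolute constant $c>0$ such that the following holds. Fix $v\ge 0$, and for every $n\in\mathbb N$ let $k=k(n)\ge 2$ be an even integer and $d=d(n)\ge 1$ an integer such that $d=o\big(n^{1/(3k^2)}\big)$ as $n\to\infty$ (for instance $k$ fixed). For every $n$ let $\mathbf A=(\mathbf A_S)_{S\in[n]^k}$ be a random symmetric real tensor of order $k$, i.e. $\mathbf A_{\pi(S)}=\mathbf A_S$ for all permutations $\pi$ of the $k$ positions, such that the entries $\mathbf A_S$, one for each orbit of index tuples under permutation, are independent, each $\mathbf A_S$ has the same law as $-\mathbf A_S$, and each is subgaussian with variance proxy $v$: $\mathbb E\,e^{t\mathbf A_S}\le e^{vt^2/2}$ for all $t\in\mathbb R$. Let $\mathbf A'$ be the asymmetrization of $\mathbf A$: $\mathbf A'_S=\sum_{\pi\in\mathcal S_k}\mathbf A_{\pi(S)}$ if $S$ is lexicographically first among all permutations of $S$, and $\mathbf A'_S=0$ otherwise. Let $A$ be the natural $n^{k/2}\times n^{k/2}$ flattening of $\mathbf A'$ (first $k/2$ indices for the row, last $k/2$ for the column), and $$C_d=\mathbb E_{\Pi,\Sigma}\big[\Pi A^{\otimes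 d}\,\Sigma\big],$$ where $\Pi,\Sigma$ are independent and uniformly distributed among the $n^{dk/2}\times n^{dk/2}$ matrices that permute the $dk/2$ coordinates of the index tuples in $[n]^{dk/2}$ by the elements of $\mathcal S_{dk/2}$. Then, with probability tending to $1$ as $n\to\infty$, $$\|C_d\|^{1/d}\;\le\;(c\log^2 n)^k\cdot d^{\frac{k^2\log d}{4\log n}}\cdot\frac{n^{k/4}}{d^{(k-2)/4}},$$ where $\|\cdot\|$ is the Euclidean operator norm. -/

import Mathlib

open Filter Topology MeasureTheory ProbabilityTheory Asymptotics
open scoped NNReal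

noncomputable section

/-- A real tensor of order `k` and dimension `n`. -/
abbrev Tensor (n k : ℕ) : Type := (Fin k → Fin n) → ℝ

/-- `S` is lexicographically first among all permutations of `S`. -/
def IsLexFirst {n k : ℕ} (S : Fin k → Fin n) : Prop :=
  ∀ π : Equiv.Perm (Fin k), toLex S ≤ toLex (S ∘ π)

open Classical in
/-- The asymmetrization of a tensor: the lexicographically first tuple in each orbit carries the sum
of the entries over all `k!` permutations of the tuple; all other entries are zero. -/
def asymmetrize {n k : ℕ} (T : Tensor n k) : Tensor n k := fun S =>
  if IsLexFirst S then ∑ π : Equiv.Perm (Fin k), T (S ∘ π) else 0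

/-- The natural `n ^ m × n ^ m` flattening of a tensor of order `2 m`: the first `m` indices give
the row, the last `m` indices give the column. -/
def flatten {n m : ℕ} (T : Tensor n (m + m)) : Matrix (Fin m → Fin n) (Fin m → Fin n) ℝ :=
  Matrix.of fun I J => T (Fin.append I J)

/-- The `d`-fold Kronecker power of an `n ^ m × n ^ m` matrix. A row (or column) index is a
`d`-tuple of elements of `[n] ^ m`, written as one tuple over the `d * m` positions
`Fin d × Fin m`. -/
def kroneckerPow {n m : ℕ} (A : Matrix (Fin m → Fin n) (Fin m → Fin n) ℝ) (d : ℕ) :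
    Matrix (Fin d × Fin m → Fin n) (Fin d × Fin m → Fin n) ℝ :=
  Matrix.of fun I J => ∏ j : Fin d, A (fun r => I (j, r)) (fun r => J (j, r))

/-- The permutation matrix on `[n] ^ ι` that permutes the `ι`-indexed coordinates by `π`. -/
def indexPermMatrix (n : ℕ) {ι : Type} [Fintype ι] [DecidableEq ι] (π : Equiv.Perm ι) :
    Matrix (ι → Fin n) (ι → Fin n) ℝ :=
  Matrix.of fun I J => if J = I ∘ π then 1 else 0

/-- The certificate `C_d = E_{Π,Σ} [Π A^{⊗ d} Σ]`, where `Π`, `Σ` are independent uniformly random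
index permutations of the `d * m` positions. -/
def certificate {n m : ℕ} (A : Matrix (Fin m → Fin n) (Fin m → Fin n) ℝ) (d : ℕ) :
    Matrix (Fin d × Fin m → Fin n) (Fin d × Fin m → Fin n) ℝ :=
  (((Fintype.card (Equiv.Perm (Fin d × Fin m)) : ℝ) ^ 2)⁻¹) •
    ∑ π : Equiv.Perm (Fin d × Fin m), ∑ τ : Equiv.Perm (Fin d × Fin m),
      indexPermMatrix n π * kroneckerPow A d * indexPermMatrix n τ

/-- The operator norm of a square real matrix with respect to the Euclidean norm. -/
def opNorm {ι : Type} [Fintype ι] [DecidableEq ι] (M : Matrix ι ι ℝ) : ℝ :=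
  ‖Matrix.toEuclideanCLM (n := ι) (𝕜 := ℝ) M‖

/-- A random symmetric tensor whose entries (one for each orbit of index tuples under permutation)
are independent, distributed symmetrically about `0`, and subgaussian with variance proxy `v`. -/
structure IsRandomSymmetricTensor {Ω : Type*} [MeasurableSpace Ω] (μ : Measure Ω) (v : ℝ≥0)
    {n k : ℕ} (T : Ω → Tensor n k) : Prop where
  measurable : ∀ S, Measurable fun ω => T ω S
  symmetric : ∀ ω S, ∀ π : Equiv.Perm (Fin k), T ω (S ∘ π) = T ω S
  independent : iIndepFun (fun (S : {S : Fin k → Fin n // IsLexFirst S}) ω => T ω S.1) μ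
  symmetricLaw : ∀ S, IdentDistrib (fun ω => T ω S) (fun ω => -T ω S) μ μ
  subgaussian : ∀ S, HasSubgaussianMGF (fun ω => T ω S) v μ

end

/-!
Averaging over index permutations is projecting onto symmetric tensors, so
`C_d = Q A^{⊗ d} Q` with `Q` the symmetric projection on all `d * m` positions (`certificate_eq`).
The Kronecker power applies `A` to one block of `m` positions after the other. Just before block `j`
is treated, the positions of the earlier blocks hold outputs and the remaining ones hold inputs; the
outer projections absorb a symmetrization of the outputs and one of the inputs, and these commute
with the action of `A` on the other positions. Hence `C_d` is the product over `j` of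
`B_j = Q_{outputs} (A on block j) Q_{inputs}` (`symProj_mul_partialKronecker_succ`,
`norm_certificate_le`).

Each `B_j` is linear in `A`, so its norm is controlled by the noncommutative Khintchine inequality
(`sum_trace_signSum_pow_le`, `card_signs_norm_gt_le`), proved by a moment recursion whose only
input is a Heinz-type trace inequality. The variance of the series is a partial trace of a symmetric
projection over `m` of its `q` positions; the partial trace over a single position multiplies the
projection by `(n + q - 1) / q` (`siteTrace_symProj`), so the variance is at most about `(n / a)^m`
with `a` the number of blocks symmetrized. One of the two sides has `j + 1` blocks and the other
`d - j`, and multiplying over `j` gives `(n^d / (d!)^2)^m · d^(dm)` up to constants, that is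
`(n / d)^(dm)` (`prod_blockVariance_le`). Per block this gains `d^{-k/4}`; the factor `√d` lost by
the Khintchine inequality in dimension `n^(dm)` turns it into `d^{-(k-2)/4}`.

To pass to the random tensor, the entries are bounded by `log n` with a union bound, and the
invariance of their joint law under sign changes reduces the probability to a count of signs
(`measure_le_of_card_signs_le`). The hypothesis on `d` forces `k ^ 2 = o(log n)`
(`eventually_sq_le_log`), so that `k!` and the variance proxy are absorbed by the powers of `log n`.
-/

/-! ### The noncommutative Khintchine inequality -/

section Khintchine

open Matrix
open scoped Matrix.Norms.L2Operator

variable {ι : Type} [Fintype ι] [DecidableEq ι]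

lemma exists_orthogonal_diagonalization {W : Matrix ι ι ℝ} (hW : W.IsHermitian) :
    ∃ (U : Matrix ι ι ℝ) (l : ι → ℝ), Uᵀ * U = 1 ∧ U * Uᵀ = 1 ∧ W = U * diagonal l * Uᵀ := by
  refine ⟨hW.eigenvectorUnitary, hW.eigenvalues, ?_, ?_, ?_⟩
  · have := Unitary.coe_star_mul_self hW.eigenvectorUnitary
    rwa [star_eq_conjTranspose, conjTranspose_eq_transpose_of_trivial] at this
  · have := Unitary.coe_mul_star_self hW.eigenvectorUnitary
    rwa [Unitary.coe_star, star_eq_conjTranspose, conjTranspose_eq_transpose_of_trivial] at this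
  · have := hW.spectral_theorem
    rw [Unitary.conjStarAlgAut_apply] at this
    rw [star_eq_conjTranspose, conjTranspose_eq_transpose_of_trivial] at this
    exact this

lemma orthogonal_conj_pow {U : Matrix ι ι ℝ} {l : ι → ℝ} (h1 : Uᵀ * U = 1) (h2 : U * Uᵀ = 1)
    (a : ℕ) : (U * diagonal l * Uᵀ) ^ a = U * diagonal (l ^ a) * Uᵀ := by
  induction a with
  | zero => simp [h2]
  | succ a ih =>
    rw [pow_succ, ih]
    calc U * diagonal (l ^ a) * Uᵀ * (U * diagonal l * Uᵀ)
        = U * diagonal (l ^ a) * (Uᵀ * U) * diagonal l * Uᵀ := by simp only [Matrix.mul_assoc]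
      _ = _ := by
        rw [h1, Matrix.mul_one, Matrix.mul_assoc U, diagonal_mul_diagonal]
        rfl

/-- In the eigenbases of `W` and `Y` the mixed trace is a sum of products of eigenvalues against
squared entries. -/
lemma trace_mul_conj_diagonal {U V H : Matrix ι ι ℝ} (hH : Hᵀ = H) (l k : ι → ℝ) :
    trace (H * (U * diagonal l * Uᵀ) * H * (V * diagonal k * Vᵀ)) =
      ∑ i, ∑ j, k i * l j * (Vᵀ * H * U) i j ^ 2 := by
  have : trace (H * (U * diagonal l * Uᵀ) * H * (V * diagonal k * Vᵀ)) =
      trace (diagonal k * ((Vᵀ * H * U) * (diagonal l * (Vᵀ * H * U)ᵀ))) := by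
    rw [transpose_mul, transpose_mul, hH, transpose_transpose,
      ← Matrix.mul_assoc (H * (U * diagonal l * Uᵀ) * H), trace_mul_comm,
      ← Matrix.mul_assoc Vᵀ, trace_mul_comm, trace_mul_comm, trace_mul_comm (diagonal k)]
    simp only [← Matrix.mul_assoc]
  rw [this, trace]
  refine Finset.sum_congr rfl fun i _ => ?_
  rw [diag_apply, diagonal_mul, mul_apply, Finset.mul_sum]
  refine Finset.sum_congr rfl fun j _ => ?_
  rw [diagonal_mul, transpose_apply]
  ring

lemma pow_mul_pow_add_le (x y : ℝ) {a b p : ℕ} (h : a + b = 2 * p) :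
    x ^ a * y ^ b + x ^ b * y ^ a ≤ x ^ (2 * p) + y ^ (2 * p) := by
  -- For nonnegative numbers this is `(u ^ a - w ^ a) * (u ^ b - w ^ b) ≥ 0`.
  have key : ∀ u w : ℝ, 0 ≤ u → 0 ≤ w →
      u ^ a * w ^ b + u ^ b * w ^ a ≤ u ^ (a + b) + w ^ (a + b) := by
    intro u w hu hw
    have : 0 ≤ (u ^ a - w ^ a) * (u ^ b - w ^ b) := by
      rcases le_total u w with h | h
      · exact mul_nonneg_of_nonpos_of_nonpos (sub_nonpos.2 (pow_le_pow_left₀ hu h a))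
          (sub_nonpos.2 (pow_le_pow_left₀ hu h b))
      · exact mul_nonneg (sub_nonneg.2 (pow_le_pow_left₀ hw h a))
          (sub_nonneg.2 (pow_le_pow_left₀ hw h b))
    rw [pow_add, pow_add]
    nlinarith
  have h1 := key |x| |y| (abs_nonneg x) (abs_nonneg y)
  rw [h, (even_two_mul p).pow_abs, (even_two_mul p).pow_abs] at h1
  refine le_trans (add_le_add ?_ ?_) h1
  · rw [← abs_pow, ← abs_pow, ← abs_mul]; exact le_abs_self _
  · rw [← abs_pow, ← abs_pow, ← abs_mul]; exact le_abs_self _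

/-- A Heinz-type trace inequality: mixed traces are dominated by the unmixed ones. -/
lemma trace_mixed_add_le {W Y H : Matrix ι ι ℝ} (hW : W.IsHermitian) (hY : Y.IsHermitian)
    (hH : Hᵀ = H) {a b p : ℕ} (h : a + b = 2 * p) :
    trace (H * W ^ a * H * Y ^ b) + trace (H * W ^ b * H * Y ^ a) ≤
      trace (H * H * W ^ (2 * p)) + trace (H * H * Y ^ (2 * p)) := by
  obtain ⟨U, l, hU1, hU2, rfl⟩ := exists_orthogonal_diagonalization hW
  obtain ⟨V, k, hV1, hV2, rfl⟩ := exists_orthogonal_diagonalization hY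
  have e1 : trace (H * H * (U * diagonal l * Uᵀ) ^ (2 * p)) =
      trace (H * (U * diagonal l * Uᵀ) ^ (2 * p) * H * (V * diagonal k * Vᵀ) ^ 0) := by
    rw [pow_zero, Matrix.mul_one, Matrix.mul_assoc, trace_mul_comm, Matrix.mul_assoc,
      ← Matrix.mul_assoc]
  have e2 : trace (H * H * (V * diagonal k * Vᵀ) ^ (2 * p)) =
      trace (H * (U * diagonal l * Uᵀ) ^ 0 * H * (V * diagonal k * Vᵀ) ^ (2 * p)) := by
    rw [pow_zero, Matrix.mul_one]
  rw [e1, e2]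
  simp only [orthogonal_conj_pow hU1 hU2, orthogonal_conj_pow hV1 hV2, trace_mul_conj_diagonal hH,
    ← Finset.sum_add_distrib]
  refine Finset.sum_le_sum fun i _ => Finset.sum_le_sum fun j _ => ?_
  simp only [Pi.pow_apply, pow_zero]
  have := pow_mul_pow_add_le (l j) (k i) h
  nlinarith [mul_le_mul_of_nonneg_right this (sq_nonneg ((Vᵀ * H * U) i j))]

lemma pow_sub_pow_eq_sum (X Y : Matrix ι ι ℝ) (N : ℕ) :
    X ^ N - Y ^ N = ∑ q ∈ Finset.range N, X ^ q * (X - Y) * Y ^ (N - 1 - q) := by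
  induction N with
  | zero => simp
  | succ N ih =>
    have : X ^ (N + 1) - Y ^ (N + 1) = (X ^ N - Y ^ N) * Y + X ^ N * (X - Y) := by
      rw [pow_succ, pow_succ]; noncomm_ring
    rw [this, ih, Finset.sum_range_succ, Finset.sum_mul]
    congr 1
    · refine Finset.sum_congr rfl fun q hq => ?_
      rw [Finset.mem_range] at hq
      rw [Matrix.mul_assoc _ _ Y, ← pow_succ]
      congr 2
      omega
    · simp

/-- The trace estimate behind one step of the moment recursion: when one sign is flipped, which
turns `X` into `Y`, the change of an odd power is controlled by unmixed traces. -/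
lemma trace_mul_pow_sub_pow_le {X Y H : Matrix ι ι ℝ} (hX : X.IsHermitian) (hY : Y.IsHermitian)
    (hH : Hᵀ = H) (p : ℕ) {e : ℝ} (he : e * e = 1) (hXY : X - Y = (2 * e) • H) :
    e * trace (H * (X ^ (2 * p + 1) - Y ^ (2 * p + 1))) ≤
      (2 * p + 1) * (trace (H * H * X ^ (2 * p)) + trace (H * H * Y ^ (2 * p))) := by
  have h1 : e * trace (H * (X ^ (2 * p + 1) - Y ^ (2 * p + 1))) =
      2 * ∑ q ∈ Finset.range (2 * p + 1), trace (H * X ^ q * H * Y ^ (2 * p - q)) := by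
    rw [pow_sub_pow_eq_sum, hXY, Finset.mul_sum, trace_sum, Finset.mul_sum, Finset.mul_sum]
    refine Finset.sum_congr rfl fun q _ => ?_
    rw [Matrix.mul_smul, Matrix.smul_mul, Matrix.mul_smul, trace_smul, smul_eq_mul]
    simp only [Nat.add_sub_cancel, Matrix.mul_assoc]
    linear_combination 2 * (H * (X ^ q * (H * Y ^ (2 * p - q)))).trace * he
  -- Each term is paired with the one where the two exponents are exchanged.
  have h2 : 2 * ∑ q ∈ Finset.range (2 * p + 1), trace (H * X ^ q * H * Y ^ (2 * p - q)) =
      ∑ q ∈ Finset.range (2 * p + 1), (trace (H * X ^ q * H * Y ^ (2 * p - q)) +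
        trace (H * X ^ (2 * p - q) * H * Y ^ q)) := by
    rw [Finset.sum_add_distrib, two_mul]
    congr 1
    rw [← Finset.sum_range_reflect]
    refine Finset.sum_congr rfl fun q hq => ?_
    rw [Finset.mem_range] at hq
    congr 3
    omega
  rw [h1, h2]
  have : (2 * p + 1 : ℝ) * (trace (H * H * X ^ (2 * p)) + trace (H * H * Y ^ (2 * p))) =
      ∑ _q ∈ Finset.range (2 * p + 1),
        (trace (H * H * X ^ (2 * p)) + trace (H * H * Y ^ (2 * p))) := by
    rw [Finset.sum_const, Finset.card_range, nsmul_eq_mul]; push_cast; ring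
  rw [this]
  refine Finset.sum_le_sum fun q hq => trace_mixed_add_le hX hY hH ?_
  rw [Finset.mem_range] at hq
  omega

/-- An even power of a symmetric matrix is positive semidefinite, so `V` may be replaced by its
upper bound under the trace. -/
lemma trace_mul_even_pow_le {V X : Matrix ι ι ℝ} (hX : X.IsHermitian) {s : ℝ}
    (hV : (s • (1 : Matrix ι ι ℝ) - V).PosSemidef) (p : ℕ) :
    trace (V * X ^ (2 * p)) ≤ s * trace (X ^ (2 * p)) := by
  have h := (hV.mul_mul_conjTranspose_same (X ^ p)).trace_nonneg
  rw [conjTranspose_pow, hX.eq, Matrix.mul_assoc, trace_mul_comm, Matrix.mul_assoc, ← pow_add,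
    ← two_mul, Matrix.sub_mul, trace_sub, Matrix.smul_mul, Matrix.one_mul, trace_smul,
    smul_eq_mul] at h
  linarith

variable {κ : Type} [Fintype κ] [DecidableEq κ]

/-- The matrix series `∑ ε_i H_i` with signs `ε`. -/
def signSum (H : κ → Matrix ι ι ℝ) (ε : κ → ℤˣ) : Matrix ι ι ℝ :=
  ∑ i, ((ε i : ℤ) : ℝ) • H i

omit [Fintype ι] [DecidableEq ι] [DecidableEq κ] in
lemma isHermitian_signSum {H : κ → Matrix ι ι ℝ} (hH : ∀ i, (H i)ᵀ = H i) (ε : κ → ℤˣ) :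
    (signSum H ε).IsHermitian := by
  rw [IsHermitian, conjTranspose_eq_transpose_of_trivial, signSum, transpose_sum]
  simp [transpose_smul, hH]

lemma sign_cast_mul_self (u : ℤˣ) : ((u : ℤ) : ℝ) * ((u : ℤ) : ℝ) = 1 := by
  rcases Int.units_eq_one_or u with h | h <;> simp [h]

omit [Fintype ι] [DecidableEq ι] in
lemma signSum_sub_flip (H : κ → Matrix ι ι ℝ) (ε : κ → ℤˣ) (i : κ) :
    signSum H ε - signSum H (ε * Pi.mulSingle i (-1)) = (2 * ((ε i : ℤ) : ℝ)) • H i := by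
  rw [signSum, signSum, ← Finset.sum_sub_distrib, Finset.sum_eq_single i]
  · rw [← sub_smul]; simp; ring_nf
  · intro j _ hj; simp [Pi.mulSingle_eq_of_ne hj]
  · simp

/-- One step of the moment recursion. Each sign is paired with its flip, which turns the odd power
into a difference. -/
lemma sum_trace_signSum_pow_succ_le {H : κ → Matrix ι ι ℝ} (hH : ∀ i, (H i)ᵀ = H i) {s : ℝ}
    (hV : (s • (1 : Matrix ι ι ℝ) - ∑ i, H i * H i).PosSemidef) (p : ℕ) :
    ∑ ε, trace (signSum H ε ^ (2 * (p + 1))) ≤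
      (2 * p + 1) * s * ∑ ε, trace (signSum H ε ^ (2 * p)) := by
  set f : κ → (κ → ℤˣ) → (κ → ℤˣ) := fun i ε => ε * Pi.mulSingle i (-1) with hf
  have hflip : ∀ (i : κ) (g : (κ → ℤˣ) → ℝ), ∑ ε, g (f i ε) = ∑ ε, g ε := fun i g =>
    Equiv.sum_comp (Equiv.mulRight (Pi.mulSingle i (-1) : κ → ℤˣ)) g
  have hfi : ∀ i ε, (((f i ε) i : ℤ) : ℝ) = - ((ε i : ℤ) : ℝ) := by
    intro i ε; simp [hf]
  have h1 : ∀ ε, trace (signSum H ε ^ (2 * (p + 1))) =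
      ∑ i, ((ε i : ℤ) : ℝ) * trace (H i * signSum H ε ^ (2 * p + 1)) := by
    intro ε
    rw [show 2 * (p + 1) = (2 * p + 1) + 1 by ring, pow_succ']
    nth_rewrite 1 [signSum]
    rw [Finset.sum_mul, trace_sum]
    simp [trace_smul]
  have h2 : ∀ i, ∑ ε : κ → ℤˣ, ((ε i : ℤ) : ℝ) * trace (H i * signSum H ε ^ (2 * p + 1)) ≤
      (2 * p + 1) * ∑ ε, trace (H i * H i * signSum H ε ^ (2 * p)) := by
    intro i
    have e1 := hflip i fun ε => ((ε i : ℤ) : ℝ) * trace (H i * signSum H ε ^ (2 * p + 1))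
    have e2 := hflip i fun ε => trace (H i * H i * signSum H ε ^ (2 * p))
    simp only [hfi] at e1
    have e3 : ∑ ε : κ → ℤˣ, ((ε i : ℤ) : ℝ) *
        trace (H i * (signSum H ε ^ (2 * p + 1) - signSum H (f i ε) ^ (2 * p + 1))) ≤
        ∑ ε : κ → ℤˣ, (2 * p + 1) * (trace (H i * H i * signSum H ε ^ (2 * p)) +
          trace (H i * H i * signSum H (f i ε) ^ (2 * p))) :=
      Finset.sum_le_sum fun ε _ => trace_mul_pow_sub_pow_le (isHermitian_signSum hH _)
        (isHermitian_signSum hH _) (hH i) p (sign_cast_mul_self _) (signSum_sub_flip H ε i)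
    rw [← Finset.mul_sum, Finset.sum_add_distrib, e2] at e3
    simp only [trace_sub, mul_sub, Finset.sum_sub_distrib] at e3
    simp only [neg_mul, Finset.sum_neg_distrib] at e1
    linarith
  calc ∑ ε, trace (signSum H ε ^ (2 * (p + 1)))
      = ∑ i, ∑ ε : κ → ℤˣ, ((ε i : ℤ) : ℝ) * trace (H i * signSum H ε ^ (2 * p + 1)) := by
        rw [Finset.sum_comm]; exact Finset.sum_congr rfl fun ε _ => h1 ε
    _ ≤ ∑ i, (2 * p + 1) * ∑ ε, trace (H i * H i * signSum H ε ^ (2 * p)) :=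
        Finset.sum_le_sum fun i _ => h2 i
    _ = (2 * p + 1) * ∑ ε, trace ((∑ i, H i * H i) * signSum H ε ^ (2 * p)) := by
        rw [← Finset.mul_sum, Finset.sum_comm]
        simp only [Finset.sum_mul, trace_sum]
    _ ≤ (2 * p + 1) * ∑ ε, s * trace (signSum H ε ^ (2 * p)) := by
        gcongr with ε
        exact trace_mul_even_pow_le (isHermitian_signSum hH ε) hV p
    _ = _ := by rw [← Finset.mul_sum]; ring

/-- The noncommutative Khintchine inequality in moment form, for Rademacher series of symmetric
matrices. -/
lemma sum_trace_signSum_pow_le {H : κ → Matrix ι ι ℝ} (hH : ∀ i, (H i)ᵀ = H i) {s : ℝ} (hs : 0 ≤ s)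
    (hV : (s • (1 : Matrix ι ι ℝ) - ∑ i, H i * H i).PosSemidef) (p q : ℕ) (hpq : q ≤ p) :
    ∑ ε, trace (signSum H ε ^ (2 * q)) ≤
      (2 * p * s) ^ q * (Fintype.card (κ → ℤˣ) * Fintype.card ι) := by
  induction q with
  | zero => simp
  | succ q ih =>
    refine (sum_trace_signSum_pow_succ_le hH hV q).trans ?_
    have : (q : ℝ) + 1 ≤ p := by exact_mod_cast hpq
    calc (2 * q + 1) * s * ∑ ε, trace (signSum H ε ^ (2 * q))
        ≤ (2 * q + 1) * s * ((2 * p * s) ^ q * (Fintype.card (κ → ℤˣ) * Fintype.card ι)) :=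
          mul_le_mul_of_nonneg_left (ih (by omega)) (by positivity)
      _ ≤ (2 * p) * s * ((2 * p * s) ^ q * (Fintype.card (κ → ℤˣ) * Fintype.card ι)) := by
          gcongr; linarith
      _ = _ := by ring

lemma norm_pow_le_trace {X : Matrix ι ι ℝ} (hX : X.IsHermitian) (p : ℕ) (hp : p ≠ 0) :
    ‖X‖ ^ (2 * p) ≤ trace (X ^ (2 * p)) := by
  obtain ⟨U, l, hU1, hU2, rfl⟩ := exists_orthogonal_diagonalization hX
  rw [orthogonal_conj_pow hU1 hU2, trace_mul_cycle, hU1, Matrix.one_mul, trace_diagonal]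
  rcases isEmpty_or_nonempty ι with h | h
  · rw [Subsingleton.elim (U * diagonal l * Uᵀ) 0]
    simp [hp]
  have hUn : ‖U‖ ≤ 1 := by
    have : ‖Uᴴ * U‖ = ‖U‖ * ‖U‖ := l2_opNorm_conjTranspose_mul_self U
    rw [conjTranspose_eq_transpose_of_trivial, hU1, norm_one] at this
    nlinarith [norm_nonneg U]
  have hUn' : ‖Uᵀ‖ ≤ 1 := by
    rw [← conjTranspose_eq_transpose_of_trivial, l2_opNorm_conjTranspose]; exact hUn
  have h1 : ‖U * diagonal l * Uᵀ‖ ≤ ‖l‖ := by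
    calc ‖U * diagonal l * Uᵀ‖ ≤ ‖U‖ * ‖diagonal l‖ * ‖Uᵀ‖ :=
          (norm_mul_le _ _).trans (by gcongr; exact norm_mul_le _ _)
      _ ≤ 1 * ‖diagonal l‖ * 1 := by gcongr
      _ = ‖l‖ := by rw [l2_opNorm_diagonal]; ring
  obtain ⟨i, hi⟩ : ∃ i, ‖l‖ ≤ ‖l i‖ := by
    by_contra! hcon
    have hl : 0 < ‖l‖ := lt_of_le_of_lt (norm_nonneg _) (hcon (Classical.arbitrary ι))
    exact lt_irrefl _ ((pi_norm_lt_iff hl).2 hcon)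
  calc ‖U * diagonal l * Uᵀ‖ ^ (2 * p) ≤ ‖l i‖ ^ (2 * p) := by
        gcongr; exact h1.trans hi
    _ = l i ^ (2 * p) := by rw [Real.norm_eq_abs, (even_two_mul p).pow_abs]
    _ ≤ ∑ i, (l ^ (2 * p)) i := Finset.single_le_sum (f := fun i => (l ^ (2 * p)) i)
        (fun j _ => (even_two_mul p).pow_nonneg _) (Finset.mem_univ i)

/-- The Hermitian dilation of a square matrix. -/
def dilation (B : Matrix ι ι ℝ) : Matrix (ι ⊕ ι) (ι ⊕ ι) ℝ := fromBlocks 0 B Bᵀ 0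

lemma norm_le_norm_dilation (B : Matrix ι ι ℝ) : ‖B‖ ≤ ‖dilation B‖ := by
  have hone : ‖(1 : Matrix ι ι ℝ)‖ ≤ 1 := by
    rw [← diagonal_one, l2_opNorm_diagonal, pi_norm_le_iff_of_nonneg zero_le_one]
    simp
  -- The block `B` is cut out of its dilation by two partial isometries.
  set P : Matrix ι (ι ⊕ ι) ℝ := fromCols 1 0
  set Q : Matrix (ι ⊕ ι) ι ℝ := fromRows 0 1
  have hB : B = P * dilation B * Q := by
    simp [P, Q, dilation, fromCols_mul_fromBlocks, fromCols_mul_fromRows]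
  have hP : ‖P‖ ≤ 1 := by
    have h : ‖Pᴴᴴ * Pᴴ‖ = ‖Pᴴ‖ * ‖Pᴴ‖ := l2_opNorm_conjTranspose_mul_self Pᴴ
    have h' : P * Pᴴ = 1 := by
      rw [conjTranspose_fromCols_eq_fromRows_conjTranspose, fromCols_mul_fromRows]; simp
    rw [conjTranspose_conjTranspose, h', l2_opNorm_conjTranspose] at h
    nlinarith [norm_nonneg P]
  have hQ : ‖Q‖ ≤ 1 := by
    have h : ‖Qᴴ * Q‖ = ‖Q‖ * ‖Q‖ := l2_opNorm_conjTranspose_mul_self Q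
    have h' : Qᴴ * Q = 1 := by
      rw [conjTranspose_fromRows_eq_fromCols_conjTranspose, fromCols_mul_fromRows]; simp
    rw [h'] at h
    nlinarith [norm_nonneg Q]
  calc ‖B‖ = ‖P * dilation B * Q‖ := by rw [← hB]
    _ ≤ ‖P‖ * ‖dilation B‖ * ‖Q‖ :=
      (l2_opNorm_mul _ _).trans (by gcongr; exact l2_opNorm_mul _ _)
    _ ≤ 1 * ‖dilation B‖ * 1 := by gcongr
    _ = _ := by ring

lemma posSemidef_fromBlocks_diagonal {A D : Matrix ι ι ℝ} (hA : A.PosSemidef) (hD : D.PosSemidef) :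
    (fromBlocks A 0 0 D).PosSemidef := by
  convert (hA.mul_mul_conjTranspose_same (fromRows 1 0 : Matrix (ι ⊕ ι) ι ℝ)).add
    (hD.mul_mul_conjTranspose_same (fromRows 0 1 : Matrix (ι ⊕ ι) ι ℝ)) using 1
  rw [conjTranspose_fromRows_eq_fromCols_conjTranspose,
    conjTranspose_fromRows_eq_fromCols_conjTranspose, fromRows_mul, fromRows_mul]
  ext (i | i) (j | j) <;> simp [mul_fromCols]

/-- The noncommutative Khintchine inequality as a tail bound: among all choices of signs, few make
the norm of `∑ ε_i B_i` exceed `t`. -/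
lemma card_signs_norm_gt_le {B : κ → Matrix ι ι ℝ} {s : ℝ} (hs : 0 ≤ s)
    (h1 : (s • (1 : Matrix ι ι ℝ) - ∑ i, B i * (B i)ᵀ).PosSemidef)
    (h2 : (s • (1 : Matrix ι ι ℝ) - ∑ i, (B i)ᵀ * B i).PosSemidef) (p : ℕ) (hp : p ≠ 0)
    {t : ℝ} (ht : 0 ≤ t) :
    ((Finset.univ.filter fun ε : κ → ℤˣ => t < ‖signSum B ε‖).card : ℝ) * t ^ (2 * p) ≤
      (2 * p * s) ^ p * (Fintype.card (κ → ℤˣ) * (2 * Fintype.card ι)) := by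
  set H : κ → Matrix (ι ⊕ ι) (ι ⊕ ι) ℝ := fun i => dilation (B i) with hHdef
  have hH : ∀ i, (H i)ᵀ = H i := fun i => by simp [hHdef, dilation, fromBlocks_transpose]
  have hsum : ∀ ε, signSum H ε = dilation (signSum B ε) := by
    intro ε
    ext (i | i) (j | j) <;>
      simp [signSum, hHdef, dilation, Matrix.sum_apply]
  have hV : (s • (1 : Matrix (ι ⊕ ι) (ι ⊕ ι) ℝ) - ∑ i, H i * H i).PosSemidef := by
    convert posSemidef_fromBlocks_diagonal h1 h2 using 1
    have : ∑ i, H i * H i = fromBlocks (∑ i, B i * (B i)ᵀ) 0 0 (∑ i, (B i)ᵀ * B i) := by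
      simp only [hHdef, dilation, fromBlocks_multiply]
      ext (i | i) (j | j) <;> simp [Matrix.sum_apply]
    rw [this, ← fromBlocks_one, fromBlocks_smul]
    ext (i | i) (j | j) <;> simp
  have key := sum_trace_signSum_pow_le hH hs hV p p le_rfl
  rw [Fintype.card_sum] at key
  calc ((Finset.univ.filter fun ε : κ → ℤˣ => t < ‖signSum B ε‖).card : ℝ) * t ^ (2 * p)
      = ∑ ε ∈ Finset.univ.filter (fun ε : κ → ℤˣ => t < ‖signSum B ε‖), t ^ (2 * p) := by
        rw [Finset.sum_const, nsmul_eq_mul]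
    _ ≤ ∑ ε ∈ Finset.univ.filter (fun ε : κ → ℤˣ => t < ‖signSum B ε‖),
          trace (signSum H ε ^ (2 * p)) := by
        refine Finset.sum_le_sum fun ε hε => ?_
        rw [Finset.mem_filter] at hε
        refine le_trans ?_ (norm_pow_le_trace (isHermitian_signSum hH ε) p hp)
        rw [hsum]
        exact pow_le_pow_left₀ ht (hε.2.le.trans (norm_le_norm_dilation _)) _
    _ ≤ ∑ ε, trace (signSum H ε ^ (2 * p)) := by
        refine Finset.sum_le_sum_of_subset_of_nonneg (Finset.filter_subset _ _) fun ε _ _ => ?_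
        exact le_trans (by positivity) (norm_pow_le_trace (isHermitian_signSum hH ε) p hp)
    _ ≤ _ := key
    _ = _ := by push_cast; ring

end Khintchine

/-! ### Projections onto symmetric tensors -/

noncomputable section SymmetricProjections

open Matrix
open scoped Matrix.Norms.L2Operator

variable {n : ℕ} {ι : Type} [Fintype ι] [DecidableEq ι]

lemma indexPermMatrix_mul_apply (π : Equiv.Perm ι) (M : Matrix (ι → Fin n) (ι → Fin n) ℝ)
    (I J : ι → Fin n) : (indexPermMatrix n π * M) I J = M (I ∘ π) J := by
  simp [mul_apply, indexPermMatrix]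

lemma mul_indexPermMatrix_apply (π : Equiv.Perm ι) (M : Matrix (ι → Fin n) (ι → Fin n) ℝ)
    (I J : ι → Fin n) : (M * indexPermMatrix n π) I J = M I (J ∘ ⇑π⁻¹) := by
  have h : ∀ K : ι → Fin n, J = K ∘ π ↔ K = J ∘ ⇑π⁻¹ := by
    intro K
    constructor
    · rintro rfl; funext x; simp
    · rintro rfl; funext x; simp
  simp [mul_apply, indexPermMatrix, h]

lemma indexPermMatrix_mul (π σ : Equiv.Perm ι) :
    indexPermMatrix n π * indexPermMatrix n σ = indexPermMatrix n (π * σ) := by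
  ext I J
  rw [indexPermMatrix_mul_apply]
  rfl

lemma indexPermMatrix_one : indexPermMatrix n (1 : Equiv.Perm ι) = 1 := by
  ext I J
  simp [indexPermMatrix, one_apply, eq_comm]

lemma indexPermMatrix_transpose (π : Equiv.Perm ι) :
    (indexPermMatrix n π)ᵀ = indexPermMatrix n π⁻¹ := by
  ext I J
  have h : I = J ∘ π ↔ J = I ∘ ⇑π⁻¹ := by
    constructor
    · rintro rfl; funext x; simp
    · rintro rfl; funext x; simp
  simp only [indexPermMatrix, transpose_apply, of_apply, h]

/-- The permutations that move only points of `s`. -/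
def permsOn (s : Finset ι) : Finset (Equiv.Perm ι) :=
  Finset.univ.filter fun π => ∀ x, x ∉ s → π x = x

lemma mem_permsOn {s : Finset ι} {π : Equiv.Perm ι} : π ∈ permsOn s ↔ ∀ x, x ∉ s → π x = x := by
  simp [permsOn]

lemma permsOn_mono {s t : Finset ι} (h : s ⊆ t) : permsOn s ⊆ permsOn t := fun _ hπ =>
  mem_permsOn.2 fun x hx => mem_permsOn.1 hπ x fun hs => hx (h hs)

lemma one_mem_permsOn (s : Finset ι) : 1 ∈ permsOn s := mem_permsOn.2 fun _ _ => rfl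

lemma mul_mem_permsOn {s : Finset ι} {π σ : Equiv.Perm ι} (hπ : π ∈ permsOn s)
    (hσ : σ ∈ permsOn s) : π * σ ∈ permsOn s := by
  rw [mem_permsOn] at *
  intro x hx
  rw [Equiv.Perm.mul_apply, hσ x hx, hπ x hx]

lemma inv_mem_permsOn {s : Finset ι} {π : Equiv.Perm ι} (hπ : π ∈ permsOn s) :
    π⁻¹ ∈ permsOn s := by
  rw [mem_permsOn] at *
  intro x hx
  rw [Equiv.Perm.inv_eq_iff_eq, hπ x hx]

lemma card_permsOn_pos (s : Finset ι) : (0 : ℝ) < (permsOn s).card := by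
  exact_mod_cast Finset.card_pos.2 ⟨1, one_mem_permsOn s⟩

variable (n) in
/-- The sum of the index permutation matrices of all permutations of the positions in `s`. -/
def symSum (s : Finset ι) : Matrix (ι → Fin n) (ι → Fin n) ℝ :=
  ∑ π ∈ permsOn s, indexPermMatrix n π

variable (n) in
/-- The orthogonal projection onto the tensors that are symmetric in the positions in `s`, as the
average of the index permutations of `s`. -/
def symProj (s : Finset ι) : Matrix (ι → Fin n) (ι → Fin n) ℝ :=
  ((permsOn s).card : ℝ)⁻¹ • symSum n s

lemma indexPermMatrix_mul_symProj {s : Finset ι} {π : Equiv.Perm ι} (hπ : π ∈ permsOn s) :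
    indexPermMatrix n π * symProj n s = symProj n s := by
  rw [symProj, Matrix.mul_smul, symSum, Finset.mul_sum]
  congr 1
  refine Finset.sum_bij' (fun σ _ => π * σ) (fun σ _ => π⁻¹ * σ)
    (fun σ hσ => mul_mem_permsOn hπ hσ) (fun σ hσ => mul_mem_permsOn (inv_mem_permsOn hπ) hσ)
    (by simp) (by simp) fun σ _ => indexPermMatrix_mul _ _

lemma symProj_transpose (s : Finset ι) : (symProj n s)ᵀ = symProj n s := by
  rw [symProj, transpose_smul, symSum, transpose_sum]
  congr 1
  exact Finset.sum_bij' (fun σ _ => σ⁻¹) (fun σ _ => σ⁻¹) (fun σ hσ => inv_mem_permsOn hσ)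
    (fun σ hσ => inv_mem_permsOn hσ) (by simp) (by simp) fun σ _ => indexPermMatrix_transpose σ

lemma symProj_mul_symProj_of_subset {s t : Finset ι} (h : s ⊆ t) :
    symProj n s * symProj n t = symProj n t := by
  nth_rewrite 1 [symProj]
  rw [symSum, Matrix.smul_mul, Finset.sum_mul,
    Finset.sum_congr rfl fun π hπ => indexPermMatrix_mul_symProj (permsOn_mono h hπ),
    Finset.sum_const, ← Nat.cast_smul_eq_nsmul ℝ, smul_smul,
    inv_mul_cancel₀ (card_permsOn_pos s).ne', one_smul]

lemma symProj_mul_symProj_of_subset' {s t : Finset ι} (h : s ⊆ t) :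
    symProj n t * symProj n s = symProj n t := by
  have := congrArg transpose (symProj_mul_symProj_of_subset (n := n) h)
  rwa [transpose_mul, symProj_transpose, symProj_transpose] at this

lemma commute_symProj {s : Finset ι} {M : Matrix (ι → Fin n) (ι → Fin n) ℝ}
    (h : ∀ π ∈ permsOn s, Commute (indexPermMatrix n π) M) : Commute (symProj n s) M :=
  (Commute.sum_left _ _ _ h).smul_left _

lemma commute_symProj_symProj {s t : Finset ι} (h : Disjoint s t) :
    Commute (symProj n s) (symProj n t) := by
  refine commute_symProj fun π hπ => (commute_symProj fun σ hσ => ?_).symm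
  rw [Commute, SemiconjBy, indexPermMatrix_mul, indexPermMatrix_mul]
  congr 1
  have : Equiv.Perm.Disjoint σ π := by
    intro x
    by_cases hx : x ∈ s
    · exact Or.inl (mem_permsOn.1 hσ x (Finset.disjoint_left.1 h hx))
    · exact Or.inr (mem_permsOn.1 hπ x hx)
  exact this.commute

lemma symProj_empty : symProj n (∅ : Finset ι) = 1 := by
  have : permsOn (∅ : Finset ι) = {1} := by
    ext π
    simp [mem_permsOn, Equiv.ext_iff]
  rw [symProj, symSum, this]
  simp [indexPermMatrix_one]

/-- The orthogonal complement of a symmetric idempotent is positive semidefinite. -/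
lemma posSemidef_one_sub_of_projection {α : Type} [Fintype α] [DecidableEq α] {P : Matrix α α ℝ}
    (h1 : Pᵀ = P) (h2 : P * P = P) : (1 - P).PosSemidef := by
  have h := posSemidef_conjTranspose_mul_self (1 - P)
  rw [conjTranspose_eq_transpose_of_trivial, transpose_sub, transpose_one, h1] at h
  rwa [Matrix.sub_mul, Matrix.one_mul, Matrix.mul_sub, Matrix.mul_one, h2, sub_self, sub_zero] at h

lemma norm_symProj_le (s : Finset ι) : ‖symProj n s‖ ≤ 1 := by
  have h : ‖(symProj n s)ᴴ * symProj n s‖ = ‖symProj n s‖ * ‖symProj n s‖ :=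
    l2_opNorm_conjTranspose_mul_self _
  rw [conjTranspose_eq_transpose_of_trivial, symProj_transpose,
    symProj_mul_symProj_of_subset subset_rfl] at h
  by_contra! hcon
  nlinarith

/-- A permutation of `t` is a transposition `(a b)` after a permutation of `t \ {a}`. -/
lemma symSum_eq_sum_swap {t : Finset ι} {a : ι} (ha : a ∈ t) :
    symSum n t = ∑ b ∈ t, indexPermMatrix n (Equiv.swap a b) * symSum n (t.erase a) := by
  simp only [symSum, Finset.mul_sum, indexPermMatrix_mul]
  rw [← Finset.sum_product']
  refine Finset.sum_bij' (fun π _ => (π a, Equiv.swap a (π a) * π))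
    (fun x _ => Equiv.swap a x.1 * x.2)
    ?_ ?_ ?_ ?_ ?_
  · intro π hπ
    rw [mem_permsOn] at hπ
    have h1 : π a ∈ t := by
      by_contra h
      exact h (by rwa [← π.injective (hπ _ h)] at ha)
    refine Finset.mem_product.2 ⟨h1, mem_permsOn.2 fun x hx => ?_⟩
    rw [Equiv.Perm.mul_apply]
    by_cases hxa : x = a
    · rw [hxa, Equiv.swap_apply_right]
    · have hxt : x ∉ t := fun h => hx (Finset.mem_erase.2 ⟨hxa, h⟩)
      rw [hπ x hxt]
      exact Equiv.swap_apply_of_ne_of_ne hxa fun h => hxt (h ▸ h1)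
  · rintro ⟨b, σ⟩ hx
    obtain ⟨hb, hσ⟩ := Finset.mem_product.1 hx
    rw [mem_permsOn] at hσ
    refine mem_permsOn.2 fun x hx => ?_
    rw [Equiv.Perm.mul_apply, hσ x fun h => hx (Finset.mem_of_mem_erase h)]
    exact Equiv.swap_apply_of_ne_of_ne (fun h => hx (h ▸ ha)) fun h => hx (h ▸ hb)
  · intro π _
    simp [← mul_assoc]
  · rintro ⟨b, σ⟩ hx
    obtain ⟨hb, hσ⟩ := Finset.mem_product.1 hx
    have h : σ a = a := mem_permsOn.1 hσ a (Finset.notMem_erase a t)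
    simp [← mul_assoc, h]
  · intro π _
    simp [← mul_assoc]

lemma card_permsOn_eq {t : Finset ι} {a : ι} (ha : a ∈ t) :
    (permsOn t).card = t.card * (permsOn (t.erase a)).card := by
  rw [← Finset.card_product]
  -- In dimension `1` every permutation matrix is the scalar `1`, so `symSum` counts permutations.
  have h := symSum_eq_sum_swap (n := 1) ha
  simp only [symSum, Finset.mul_sum, indexPermMatrix_mul] at h
  have h2 := congrFun (congrFun h fun _ => 0) fun _ => 0
  simp only [Matrix.sum_apply, indexPermMatrix, of_apply] at h2
  rw [Finset.card_product]
  have h3 : ∀ π : Equiv.Perm ι, (fun _ => (0 : Fin 1)) = (fun _ => (0 : Fin 1)) ∘ π := fun _ => rfl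
  simp only [← h3, if_true, Finset.sum_const, smul_smul] at h2
  simp only [nsmul_eq_mul, mul_one] at h2
  exact_mod_cast h2

end SymmetricProjections

/-! ### Partial traces of symmetric projections -/

noncomputable section PartialTrace

open Matrix

variable {n : ℕ} {ι : Type} [Fintype ι] [DecidableEq ι]

/-- The partial trace over the position `a`, tensored with the identity on that position. -/
def siteTrace (a : ι) (M : Matrix (ι → Fin n) (ι → Fin n) ℝ) : Matrix (ι → Fin n) (ι → Fin n) ℝ :=
  of fun K L => if K a = L a then
    ∑ v, M (Function.update K a v) (Function.update L a v) else 0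

/-- The partial trace over the positions `e r`, tensored with the identity on those positions. -/
def partialTrace {l : ℕ} (e : Fin l → ι) (M : Matrix (ι → Fin n) (ι → Fin n) ℝ) :
    Matrix (ι → Fin n) (ι → Fin n) ℝ :=
  of fun K L => if K ∘ e = L ∘ e then
    ∑ J : Fin l → Fin n, M (Function.extend e J K) (Function.extend e J L) else 0

omit [Fintype ι] in
lemma siteTrace_smul (a : ι) (c : ℝ) (M : Matrix (ι → Fin n) (ι → Fin n) ℝ) :
    siteTrace a (c • M) = c • siteTrace a M := by
  ext K L
  simp [siteTrace, Finset.mul_sum]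

omit [Fintype ι] in
lemma siteTrace_sum {β : Type} (a : ι) (s : Finset β) (M : β → Matrix (ι → Fin n) (ι → Fin n) ℝ) :
    siteTrace a (∑ b ∈ s, M b) = ∑ b ∈ s, siteTrace a (M b) := by
  ext K L
  simp only [siteTrace, of_apply, Matrix.sum_apply]
  split_ifs with h
  · rw [Finset.sum_comm]
  · simp

omit [Fintype ι] [DecidableEq ι] in
lemma partialTrace_smul {l : ℕ} (e : Fin l → ι) (c : ℝ) (M : Matrix (ι → Fin n) (ι → Fin n) ℝ) :
    partialTrace e (c • M) = c • partialTrace e M := by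
  ext K L
  simp [partialTrace, Finset.mul_sum]

lemma siteTrace_mul_indexPermMatrix (a : ι) (M : Matrix (ι → Fin n) (ι → Fin n) ℝ)
    {σ : Equiv.Perm ι} (hσ : σ a = a) :
    siteTrace a (M * indexPermMatrix n σ) = siteTrace a M * indexPermMatrix n σ := by
  ext K L
  have hσ' : σ⁻¹ a = a := by rw [Equiv.Perm.inv_eq_iff_eq, hσ]
  have h : ∀ v, Function.update L a v ∘ ⇑σ⁻¹ = Function.update (L ∘ ⇑σ⁻¹) a v := by
    intro v
    funext x
    by_cases hx : x = a
    · rw [hx, Function.comp_apply, hσ', Function.update_self, Function.update_self]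
    · have : σ⁻¹ x ≠ a := fun h => hx (by rw [← hσ', σ⁻¹.injective.eq_iff] at h; exact h)
      rw [Function.comp_apply, Function.update_of_ne hx, Function.update_of_ne this,
        Function.comp_apply]
  rw [mul_indexPermMatrix_apply]
  simp only [siteTrace, of_apply, mul_indexPermMatrix_apply, h, Function.comp_apply, hσ']

lemma siteTrace_one (a : ι) :
    siteTrace a (1 : Matrix (ι → Fin n) (ι → Fin n) ℝ) = (n : ℝ) • 1 := by
  ext K L
  simp only [siteTrace, of_apply, Matrix.smul_apply, one_apply, smul_eq_mul]
  by_cases hKL : K = L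
  · simp [hKL]
  · rw [if_neg hKL, mul_zero]
    split_ifs with h
    · refine Finset.sum_eq_zero fun v _ => if_neg fun h' => hKL ?_
      funext x
      by_cases hx : x = a
      · rw [hx, h]
      · simpa [hx] using congrFun h' x
    · rfl

lemma siteTrace_swap {a b : ι} (hab : a ≠ b) :
    siteTrace a (indexPermMatrix n (Equiv.swap a b)) = 1 := by
  ext K L
  simp only [siteTrace, of_apply, indexPermMatrix, one_apply]
  have key : ∀ v, K a = L a → (Function.update L a v = Function.update K a v ∘ Equiv.swap a b ↔
      v = K b ∧ K = L) := by
    intro v ha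
    constructor
    · intro h
      have h1 := congrFun h a
      have h2 := congrFun h b
      simp only [Function.comp_apply, Equiv.swap_apply_left, Equiv.swap_apply_right,
        Function.update_self, Function.update_of_ne hab.symm] at h1 h2
      refine ⟨h1, funext fun x => ?_⟩
      by_cases hxa : x = a
      · rw [hxa, ha]
      by_cases hxb : x = b
      · rw [hxb, h2, h1]
      have h3 := congrFun h x
      rw [Function.comp_apply, Equiv.swap_apply_of_ne_of_ne hxa hxb, Function.update_of_ne hxa,
        Function.update_of_ne hxa] at h3
      exact h3.symm
    · rintro ⟨rfl, rfl⟩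
      funext x
      rw [Function.comp_apply]
      by_cases hxa : x = a
      · subst hxa; simp [hab.symm]
      by_cases hxb : x = b
      · subst hxb; simp [hab.symm]
      rw [Equiv.swap_apply_of_ne_of_ne hxa hxb, Function.update_of_ne hxa]
  by_cases hKL : K = L
  · subst hKL
    simp [key]
  · rw [if_neg hKL]
    split_ifs with h
    · exact Finset.sum_eq_zero fun v _ => if_neg fun h' => hKL ((key v h).1 h').2
    · rfl

/-- Tracing out one of the `q` positions of the symmetric projection gives a multiple of the
symmetric projection on the others: of the `q` cosets, the trivial one contributes `n` and each
of the other `q - 1` contributes `1`. -/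
lemma siteTrace_symProj {t : Finset ι} {a : ι} (ha : a ∈ t) :
    siteTrace a (symProj n t) = (((n : ℝ) + t.card - 1) / t.card) • symProj n (t.erase a) := by
  have h1 : ∀ b, siteTrace a (indexPermMatrix n (Equiv.swap a b) * symSum n (t.erase a)) =
      siteTrace a (indexPermMatrix n (Equiv.swap a b)) * symSum n (t.erase a) := by
    intro b
    rw [symSum, Finset.mul_sum, siteTrace_sum, Finset.mul_sum]
    exact Finset.sum_congr rfl fun σ hσ =>
      siteTrace_mul_indexPermMatrix a _ (mem_permsOn.1 hσ a (Finset.notMem_erase a t))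
  have h2 : siteTrace a (symSum n t) = ((n : ℝ) + t.card - 1) • symSum n (t.erase a) := by
    rw [symSum_eq_sum_swap ha, siteTrace_sum, ← Finset.add_sum_erase _ _ ha]
    rw [Finset.sum_congr rfl fun b hb => by
      rw [h1 b, siteTrace_swap (Finset.ne_of_mem_erase hb).symm, Matrix.one_mul]]
    rw [h1 a, Equiv.swap_self, ← Equiv.Perm.one_def, indexPermMatrix_one, siteTrace_one,
      Matrix.smul_mul, Matrix.one_mul, Finset.sum_const, Finset.card_erase_of_mem ha,
      ← Nat.cast_smul_eq_nsmul ℝ, ← add_smul, Nat.cast_sub (Finset.card_pos.2 ⟨a, ha⟩)]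
    congr 1
    push_cast
    ring
  have h3 : (0 : ℝ) < t.card := by exact_mod_cast Finset.card_pos.2 ⟨a, ha⟩
  rw [symProj, siteTrace_smul, h2, symProj, smul_smul, smul_smul, card_permsOn_eq ha]
  congr 1
  have := card_permsOn_pos (t.erase a)
  push_cast
  field_simp

omit [Fintype ι] in
lemma extend_cons_tail {l : ℕ} {e : Fin (l + 1) → ι} (he : Function.Injective e) (v : Fin n)
    (J : Fin l → Fin n) (K : ι → Fin n) :
    Function.extend e (Fin.cons v J : Fin (l + 1) → Fin n) K =
      Function.update (Function.extend (Fin.tail e) J K) (e 0) v := by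
  have het : Function.Injective (Fin.tail e) := fun x y h => Fin.succ_injective _ (he h)
  funext x
  by_cases hx : ∃ r, e r = x
  · obtain ⟨r, rfl⟩ := hx
    rw [he.extend_apply]
    refine Fin.cases ?_ (fun r => ?_) r
    · simp
    · rw [Function.update_of_ne (he.ne (Fin.succ_ne_zero r)), Fin.cons_succ,
        show e r.succ = Fin.tail e r from rfl, het.extend_apply]
  · rw [Function.extend_apply' _ _ _ hx, Function.update_of_ne fun h => hx ⟨0, h.symm⟩,
      Function.extend_apply' _ _ _ fun ⟨r, hr⟩ => hx ⟨r.succ, hr⟩]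

omit [Fintype ι] in
lemma partialTrace_succ {l : ℕ} {e : Fin (l + 1) → ι} (he : Function.Injective e)
    (M : Matrix (ι → Fin n) (ι → Fin n) ℝ) :
    partialTrace e M = partialTrace (Fin.tail e) (siteTrace (e 0) M) := by
  ext K L
  have h0 : ∀ (J : Fin l → Fin n) (K : ι → Fin n),
      Function.extend (Fin.tail e) J K (e 0) = K (e 0) :=
    fun J K => Function.extend_apply' _ _ _ fun ⟨r, hr⟩ => Fin.succ_ne_zero r (he hr)
  have hiff : K ∘ e = L ∘ e ↔ K ∘ Fin.tail e = L ∘ Fin.tail e ∧ K (e 0) = L (e 0) := by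
    simp only [funext_iff, Fin.forall_fin_succ, Function.comp_apply, Fin.tail]
    tauto
  simp only [partialTrace, siteTrace, of_apply, h0, hiff]
  by_cases h1 : K ∘ Fin.tail e = L ∘ Fin.tail e
  · by_cases h2 : K (e 0) = L (e 0)
    · simp only [h1, h2, and_self, if_true]
      rw [← (Fin.consEquiv fun _ : Fin (l + 1) => Fin n).sum_comp, Fintype.sum_prod_type,
        Finset.sum_comm]
      refine Finset.sum_congr rfl fun J _ => Finset.sum_congr rfl fun v _ => ?_
      rw [← extend_cons_tail he, ← extend_cons_tail he]
      rfl
    · simp [h2]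
  · simp [h1]

lemma partialTrace_symProj {l : ℕ} {e : Fin l → ι} (he : Function.Injective e) {t : Finset ι}
    (ht : ∀ r, e r ∈ t) :
    partialTrace e (symProj n t) =
      (∏ i ∈ Finset.range l, ((n : ℝ) + t.card - 1 - i) / (t.card - i)) •
        symProj n (t \ Finset.univ.image e) := by
  induction l generalizing t with
  | zero =>
    ext K L
    have h : ∀ (J : Fin 0 → Fin n) (K : ι → Fin n), Function.extend e J K = K := fun J K =>
      funext fun x => Function.extend_apply' _ _ _ fun ⟨r, _⟩ => r.elim0
    simp [partialTrace, h, Subsingleton.elim (K ∘ e) (L ∘ e)]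
  | succ l ih =>
    have het : Function.Injective (Fin.tail e) := fun x y h => Fin.succ_injective _ (he h)
    rw [partialTrace_succ he, siteTrace_symProj (ht 0), partialTrace_smul,
      ih het fun r => Finset.mem_erase.2 ⟨he.ne (Fin.succ_ne_zero r), ht _⟩, smul_smul]
    congr 1
    · rw [Finset.prod_range_succ', mul_comm, Finset.card_erase_of_mem (ht 0),
        Nat.cast_sub (Finset.card_pos.2 ⟨_, ht 0⟩)]
      congr 1
      · refine Finset.prod_congr rfl fun i _ => ?_
        push_cast
        congr 1 <;> ring
      · simp
    · congr 1
      ext x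
      simp only [Finset.mem_sdiff, Finset.mem_erase, Finset.mem_image, Finset.mem_univ, true_and,
        Fin.exists_fin_succ, Fin.tail]
      tauto

end PartialTrace

/-! ### Matrices acting on a block of positions -/

noncomputable section Lifting

open Matrix
open scoped Matrix.Norms.L2Operator

variable {n m : ℕ} {ι : Type} [Fintype ι] [DecidableEq ι]

/-- The matrix `A` acting on the positions `e r`, tensored with the identity on all others. -/
def liftMatrix (e : Fin m → ι) (A : Matrix (Fin m → Fin n) (Fin m → Fin n) ℝ) :
    Matrix (ι → Fin n) (ι → Fin n) ℝ :=
  of fun I J => if ∀ x, (∀ r, e r ≠ x) → I x = J x then A (I ∘ e) (J ∘ e) else 0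

lemma liftMatrix_transpose (e : Fin m → ι) (A : Matrix (Fin m → Fin n) (Fin m → Fin n) ℝ) :
    (liftMatrix e A)ᵀ = liftMatrix e Aᵀ := by
  ext I J
  simp only [liftMatrix, transpose_apply, of_apply, eq_comm]

lemma liftMatrix_smul (e : Fin m → ι) (c : ℝ) (A : Matrix (Fin m → Fin n) (Fin m → Fin n) ℝ) :
    liftMatrix e (c • A) = c • liftMatrix e A := by
  ext I J
  simp [liftMatrix]

lemma liftMatrix_sum {β : Type} (e : Fin m → ι) (s : Finset β)
    (A : β → Matrix (Fin m → Fin n) (Fin m → Fin n) ℝ) :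
    liftMatrix e (∑ b ∈ s, A b) = ∑ b ∈ s, liftMatrix e (A b) := by
  ext I J
  simp only [liftMatrix, of_apply, Matrix.sum_apply]
  split_ifs <;> simp

lemma commute_indexPermMatrix_liftMatrix {e : Fin m → ι} {π : Equiv.Perm ι}
    (hπ : ∀ r, π (e r) = e r) (A : Matrix (Fin m → Fin n) (Fin m → Fin n) ℝ) :
    Commute (indexPermMatrix n π) (liftMatrix e A) := by
  have hπ' : ∀ r, π⁻¹ (e r) = e r := fun r => by rw [Equiv.Perm.inv_eq_iff_eq, hπ]
  ext I J
  rw [indexPermMatrix_mul_apply, mul_indexPermMatrix_apply]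
  have h1 : (I ∘ π) ∘ e = I ∘ e := funext fun r => by simp [hπ]
  have h2 : (J ∘ ⇑π⁻¹) ∘ e = J ∘ e := funext fun r => by
    rw [Function.comp_apply, Function.comp_apply, hπ', Function.comp_apply]
  have h3 : (∀ x, (∀ r, e r ≠ x) → (I ∘ π) x = J x) ↔
      ∀ x, (∀ r, e r ≠ x) → I x = (J ∘ ⇑π⁻¹) x := by
    constructor
    · intro h x hx
      have := h (π⁻¹ x) fun r hr => hx r (by rw [← hπ, hr]; simp)
      simpa using this
    · intro h x hx
      have := h (π x) fun r hr => hx r (π.injective (by rw [hπ, hr]))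
      simpa using this
  simp only [liftMatrix, of_apply, h1, h2, h3]

lemma commute_symProj_liftMatrix {e : Fin m → ι} {s : Finset ι} (hs : ∀ r, e r ∉ s)
    (A : Matrix (Fin m → Fin n) (Fin m → Fin n) ℝ) :
    Commute (symProj n s) (liftMatrix e A) :=
  commute_symProj fun _ hπ =>
    commute_indexPermMatrix_liftMatrix (fun r => mem_permsOn.1 hπ _ (hs r)) A

lemma liftMatrix_single_apply {e : Fin m → ι} (he : Function.Injective e) (P Q : Fin m → Fin n)
    (I J : ι → Fin n) :
    liftMatrix e (single P Q 1) I J = if P = I ∘ e ∧ J = Function.extend e Q I then 1 else 0 := by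
  have h : (∀ x, (∀ r, e r ≠ x) → I x = J x) ∧ Q = J ∘ e ↔ J = Function.extend e Q I := by
    constructor
    · rintro ⟨h1, rfl⟩
      funext x
      by_cases hx : ∃ r, e r = x
      · obtain ⟨r, rfl⟩ := hx
        rw [he.extend_apply]; rfl
      · rw [Function.extend_apply' _ _ _ hx, h1 x fun r hr => hx ⟨r, hr⟩]
    · rintro rfl
      refine ⟨fun x hx => ?_, funext fun r => ?_⟩
      · rw [Function.extend_apply' _ _ _ fun ⟨r, hr⟩ => hx r hr]
      · rw [Function.comp_apply, he.extend_apply]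
  simp only [liftMatrix, of_apply, single_apply, ← ite_and, ← h]
  congr 1
  apply propext
  tauto

/-- Summing the conjugates by all matrix units on the positions `e r` is the partial trace. -/
lemma sum_liftMatrix_single_conj {e : Fin m → ι} (he : Function.Injective e)
    (M : Matrix (ι → Fin n) (ι → Fin n) ℝ) :
    ∑ P, ∑ Q, liftMatrix e (single P Q 1) * M * (liftMatrix e (single P Q 1))ᵀ =
      partialTrace e M := by
  ext K L
  have h : ∀ P Q, (liftMatrix e (single P Q 1) * M * (liftMatrix e (single P Q 1))ᵀ) K L =
      if P = K ∘ e ∧ P = L ∘ e then M (Function.extend e Q K) (Function.extend e Q L) else 0 := by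
    intro P Q
    simp only [mul_apply, transpose_apply, liftMatrix_single_apply he, ite_and, ite_mul, one_mul,
      zero_mul, mul_ite, mul_one, mul_zero]
    by_cases h1 : P = K ∘ e <;> by_cases h2 : P = L ∘ e <;> simp [h1, h2]
  simp only [Matrix.sum_apply, h, partialTrace, of_apply]
  rw [Finset.sum_eq_single (K ∘ e)]
  · simp only [true_and]
    split_ifs <;> simp
  · intro P _ hP
    simp [hP]
  · simp

lemma flatten_eq_sum (T : Tensor n (m + m)) :
    flatten T = ∑ S : Fin (m + m) → Fin n,
      T S • single (S ∘ Fin.castAdd m) (S ∘ Fin.natAdd m) 1 := by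
  ext I J
  rw [Matrix.sum_apply, Finset.sum_eq_single (Fin.append I J)]
  · have h1 : Fin.append I J ∘ Fin.castAdd m = I := funext fun r => by simp
    have h2 : Fin.append I J ∘ Fin.natAdd m = J := funext fun r => Fin.append_right I J r
    simp [flatten, h1, h2]
  · intro S _ hS
    rw [Matrix.smul_apply, single_apply, if_neg, smul_zero]
    rintro ⟨rfl, rfl⟩
    exact hS (Fin.append_castAdd_natAdd).symm
  · simp

/-- The matrix unit of the entry `S` of the flattened tensor, placed on the positions `e r` and
symmetrized on the left in `s` and on the right in `t`. -/
def entryTerm (e : Fin m → ι) (s t : Finset ι) (S : Fin (m + m) → Fin n) :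
    Matrix (ι → Fin n) (ι → Fin n) ℝ :=
  symProj n s * liftMatrix e (single (S ∘ Fin.castAdd m) (S ∘ Fin.natAdd m) 1) * symProj n t

lemma symProj_mul_liftMatrix_flatten (e : Fin m → ι) (s t : Finset ι) (T : Tensor n (m + m)) :
    symProj n s * liftMatrix e (flatten T) * symProj n t = ∑ S, T S • entryTerm e s t S := by
  simp only [flatten_eq_sum, liftMatrix_sum, liftMatrix_smul, Finset.mul_sum, Finset.sum_mul,
    entryTerm, Matrix.mul_smul, Matrix.smul_mul]

lemma sum_entryTerm_mul_transpose {e : Fin m → ι} (he : Function.Injective e) (s t : Finset ι) :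
    ∑ S, entryTerm e s t S * (entryTerm (n := n) e s t S)ᵀ =
      symProj n s * partialTrace e (symProj n t) * symProj n s := by
  rw [← sum_liftMatrix_single_conj he, ← Fintype.sum_prod_type', Finset.mul_sum, Finset.sum_mul,
    ← (Fin.appendEquiv m m).sum_comp]
  refine Finset.sum_congr rfl fun x _ => ?_
  have h1 : Fin.append x.1 x.2 ∘ Fin.castAdd m = x.1 := funext fun r => by simp
  have h2 : Fin.append x.1 x.2 ∘ Fin.natAdd m = x.2 := funext fun r => Fin.append_right _ _ r
  have h3 := symProj_mul_symProj_of_subset (n := n) (subset_refl t)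
  simp only [entryTerm, Fin.appendEquiv, Equiv.coe_fn_mk, h1, h2, transpose_mul, symProj_transpose]
  calc _ = symProj n s * liftMatrix e (single x.1 x.2 1) * (symProj n t * symProj n t) *
        ((liftMatrix e (single x.1 x.2 1))ᵀ * symProj n s) := by simp only [Matrix.mul_assoc]
    _ = _ := by rw [h3]; simp only [Matrix.mul_assoc]

lemma sum_transpose_mul_entryTerm {e : Fin m → ι} (he : Function.Injective e) (s t : Finset ι) :
    ∑ S, (entryTerm (n := n) e s t S)ᵀ * entryTerm e s t S =
      symProj n t * partialTrace e (symProj n s) * symProj n t := by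
  rw [← sum_entryTerm_mul_transpose he]
  refine Fintype.sum_equiv ((Fin.appendEquiv m m).symm.trans ((Equiv.prodComm _ _).trans
    (Fin.appendEquiv m m))) _ _ fun S => ?_
  have h1 : Fin.append (S ∘ Fin.natAdd m) (S ∘ Fin.castAdd m) ∘ Fin.castAdd m =
    S ∘ Fin.natAdd m := funext fun r => by simp
  have h2 : Fin.append (S ∘ Fin.natAdd m) (S ∘ Fin.castAdd m) ∘ Fin.natAdd m =
    S ∘ Fin.castAdd m := funext fun r => Fin.append_right _ _ r
  have : entryTerm e t s (((Fin.appendEquiv m m).symm.trans ((Equiv.prodComm _ _).trans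
    (Fin.appendEquiv m m))) S) = (entryTerm (n := n) e s t S)ᵀ := by
    have h3 : ((Fin.appendEquiv m m).symm.trans ((Equiv.prodComm _ _).trans
      (Fin.appendEquiv m m))) S = Fin.append (S ∘ Fin.natAdd m) (S ∘ Fin.castAdd m) := rfl
    rw [h3, entryTerm, entryTerm, h1, h2, transpose_mul, transpose_mul, symProj_transpose,
      symProj_transpose, liftMatrix_transpose, transpose_single, Matrix.mul_assoc]
  rw [this, transpose_transpose]

/-- A weighted partial sum of the matrices `G_S G_Sᵀ` is dominated by the full sum. -/
lemma posSemidef_sub_weighted_sum {α β : Type} [Fintype α] [DecidableEq α] [Fintype β]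
    (q : β → Prop) [DecidablePred q] {G : β → Matrix α α ℝ} {P : Matrix α α ℝ} {c c' L : ℝ}
    (hP : (1 - P).PosSemidef) (hG : ∑ S, G S * (G S)ᵀ = c • P) (hc : 0 ≤ c) (hcc : c ≤ c')
    {w : {S // q S} → ℝ} (hw : ∀ i, w i ^ 2 ≤ L ^ 2) :
    ((L ^ 2 * c') • (1 : Matrix α α ℝ) -
      ∑ i : {S // q S}, (w i • G i.1) * (w i • G i.1)ᵀ).PosSemidef := by
  have hGG : ∀ S, (G S * (G S)ᵀ).PosSemidef := fun S => by
    rw [← conjTranspose_eq_transpose_of_trivial]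
    exact posSemidef_self_mul_conjTranspose _
  have key : (L ^ 2 * c') • (1 : Matrix α α ℝ) -
      ∑ i : {S // q S}, (w i • G i.1) * (w i • G i.1)ᵀ =
      (L ^ 2 * (c' - c)) • (1 : Matrix α α ℝ) + (L ^ 2 * c) • (1 - P) +
        ∑ i : {S // q S}, (L ^ 2 - w i ^ 2) • (G i.1 * (G i.1)ᵀ) +
        ∑ i : {S // ¬ q S}, L ^ 2 • (G i.1 * (G i.1)ᵀ) := by
    have h := Fintype.sum_subtype_add_sum_subtype q fun S => G S * (G S)ᵀ
    rw [hG] at h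
    have h1 : ∀ i : {S // q S}, (w i • G i.1) * (w i • G i.1)ᵀ = w i ^ 2 • (G i.1 * (G i.1)ᵀ) := by
      intro i
      rw [transpose_smul, Matrix.smul_mul, Matrix.mul_smul, smul_smul, sq]
    simp only [h1, sub_smul, Finset.sum_sub_distrib, ← Finset.smul_sum, mul_sub, smul_sub]
    rw [mul_smul (L ^ 2) c P, ← h, smul_add]
    abel
  rw [key]
  refine ((((PosSemidef.one).smul ?_).add (hP.smul ?_)).add
    (posSemidef_sum _ fun i _ => (hGG _).smul ?_)).add (posSemidef_sum _ fun i _ => (hGG _).smul ?_)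
  · exact mul_nonneg (sq_nonneg _) (sub_nonneg.2 hcc)
  · exact mul_nonneg (sq_nonneg _) hc
  · exact sub_nonneg.2 (hw i)
  · exact sq_nonneg _

lemma posSemidef_one_sub_symProj_mul {s t : Finset ι} (h : Disjoint s t) :
    (1 - symProj n s * symProj n t * symProj n s).PosSemidef := by
  have hst := (commute_symProj_symProj (n := n) h).eq
  have h1 := symProj_mul_symProj_of_subset (n := n) (subset_refl s)
  have h2 := symProj_mul_symProj_of_subset (n := n) (subset_refl t)
  have h3 : symProj n s * symProj n t * symProj n s = symProj n s * symProj n t := by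
    rw [Matrix.mul_assoc, ← hst, ← Matrix.mul_assoc, h1]
  rw [h3]
  refine posSemidef_one_sub_of_projection ?_ ?_
  · rw [transpose_mul, symProj_transpose, symProj_transpose, hst]
  · rw [← Matrix.mul_assoc, h3, Matrix.mul_assoc, h2]

variable (n m) in
/-- The constant by which the partial trace over `m` of `q` positions scales the symmetric
projection. -/
def traceFactor (q : ℕ) : ℝ := ∏ i ∈ Finset.range m, ((n : ℝ) + q - 1 - i) / (q - i)

/-- The Khintchine tail bound for a symmetrized block: the variance of the series is read off from
the partial traces of the two symmetric projections. -/
lemma card_signs_entryTerm_le {e : Fin m → ι} (he : Function.Injective e) {s t : Finset ι}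
    (hes : ∀ r, e r ∈ s) (het : ∀ r, e r ∈ t) (hst : Disjoint s (t \ Finset.univ.image e))
    (hts : Disjoint t (s \ Finset.univ.image e)) (q : (Fin (m + m) → Fin n) → Prop)
    [DecidablePred q] {c L : ℝ} (hs0 : 0 ≤ traceFactor n m s.card)
    (ht0 : 0 ≤ traceFactor n m t.card)
    (hsc : traceFactor n m s.card ≤ c) (htc : traceFactor n m t.card ≤ c)
    {w : {S // q S} → ℝ} (hw : ∀ i, w i ^ 2 ≤ L ^ 2) (p : ℕ) (hp : p ≠ 0) {u : ℝ} (hu : 0 ≤ u) :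
    ((Finset.univ.filter fun ε : {S // q S} → ℤˣ =>
      u < ‖signSum (fun i => w i • entryTerm (n := n) e s t i.1) ε‖).card : ℝ) * u ^ (2 * p) ≤
      (2 * p * (L ^ 2 * c)) ^ p *
        (Fintype.card ({S // q S} → ℤˣ) * (2 * (n : ℝ) ^ Fintype.card ι)) := by
  have h1 := sum_entryTerm_mul_transpose (n := n) he s t
  have h2 := sum_transpose_mul_entryTerm (n := n) he s t
  rw [partialTrace_symProj he het, Matrix.mul_smul, Matrix.smul_mul] at h1
  rw [partialTrace_symProj he hes, Matrix.mul_smul, Matrix.smul_mul] at h2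
  have key := card_signs_norm_gt_le (B := fun i : {S // q S} => w i • entryTerm (n := n) e s t i.1)
    (s := L ^ 2 * c) (mul_nonneg (sq_nonneg _) (hs0.trans hsc))
    (posSemidef_sub_weighted_sum q (posSemidef_one_sub_symProj_mul hst) h1 ht0 htc hw)
    (by
      have := posSemidef_sub_weighted_sum q (G := fun S => (entryTerm (n := n) e s t S)ᵀ)
        (posSemidef_one_sub_symProj_mul hts)
        (by simpa only [transpose_transpose, traceFactor] using h2) hs0 hsc hw
      simpa using this) p hp hu
  simpa using key

end Lifting

/-! ### Factorization of the certificate -/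

noncomputable section Blocks

open Matrix
open scoped Matrix.Norms.L2Operator

variable {n m d : ℕ}

variable (m d) in
/-- The positions in the blocks before block `l`. -/
def blocksBefore (l : ℕ) : Finset (Fin d × Fin m) := Finset.univ.filter fun x => x.1.val < l

variable (m d) in
/-- The positions in block `l` and the blocks after it. -/
def blocksFrom (l : ℕ) : Finset (Fin d × Fin m) := Finset.univ.filter fun x => l ≤ x.1.val

/-- The block `j` of positions. -/
def blockEmb (j : Fin d) (r : Fin m) : Fin d × Fin m := (j, r)

lemma mem_blocksBefore {l : ℕ} {x : Fin d × Fin m} : x ∈ blocksBefore m d l ↔ x.1.val < l := by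
  simp [blocksBefore]

lemma mem_blocksFrom {l : ℕ} {x : Fin d × Fin m} : x ∈ blocksFrom m d l ↔ l ≤ x.1.val := by
  simp [blocksFrom]

lemma blockEmb_injective (j : Fin d) : Function.Injective (blockEmb (m := m) j) := fun _ _ h =>
  (Prod.mk.inj h).2

lemma card_blocksBefore {l : ℕ} (hl : l ≤ d) : (blocksBefore m d l).card = l * m := by
  have : blocksBefore m d l =
      (Finset.univ.filter fun j : Fin d => j.val < l) ×ˢ (Finset.univ : Finset (Fin m)) := by
    ext x; simp [mem_blocksBefore]
  rw [this, Finset.card_product, Finset.card_univ, Fintype.card_fin, Fin.card_filter_val_lt,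
    min_eq_right hl]

lemma card_blocksFrom {l : ℕ} (hl : l ≤ d) : (blocksFrom m d l).card = (d - l) * m := by
  have h : blocksFrom m d l = (blocksBefore m d l)ᶜ := by
    ext x; simp [mem_blocksBefore, mem_blocksFrom]
  rw [h, Finset.card_compl, card_blocksBefore hl, Fintype.card_prod, Fintype.card_fin,
    Fintype.card_fin, Nat.sub_mul]

/-- The Kronecker product of copies of `A` on the blocks before block `l`, tensored with the
identity on all other blocks. -/
def partialKronecker (A : Matrix (Fin m → Fin n) (Fin m → Fin n) ℝ) (d l : ℕ) :
    Matrix (Fin d × Fin m → Fin n) (Fin d × Fin m → Fin n) ℝ :=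
  of fun I J => if ∀ x : Fin d × Fin m, l ≤ x.1.val → I x = J x then
    ∏ j ∈ Finset.univ.filter (fun j : Fin d => j.val < l),
      A (I ∘ blockEmb j) (J ∘ blockEmb j) else 0

lemma partialKronecker_zero (A : Matrix (Fin m → Fin n) (Fin m → Fin n) ℝ) :
    partialKronecker A d 0 = 1 := by
  ext I J
  simp [partialKronecker, one_apply, funext_iff]

lemma partialKronecker_self (A : Matrix (Fin m → Fin n) (Fin m → Fin n) ℝ) :
    partialKronecker A d d = kroneckerPow A d := by
  ext I J
  simp only [partialKronecker, kroneckerPow, of_apply]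
  rw [if_pos fun x hx => absurd hx (by omega), Finset.filter_true_of_mem fun j _ => j.2]
  rfl

lemma partialKronecker_succ (A : Matrix (Fin m → Fin n) (Fin m → Fin n) ℝ) (j : Fin d) :
    partialKronecker A d (j.val + 1) = liftMatrix (blockEmb j) A * partialKronecker A d j.val := by
  ext I J
  rw [mul_apply, Finset.sum_eq_single fun x => if x.1 = j then J x else I x]
  · have h0 : ∀ x : Fin d × Fin m, (∀ r, blockEmb j r ≠ x) →
        I x = if x.1 = j then J x else I x := fun x hx =>
      (if_neg fun h => hx x.2 (by rw [blockEmb, ← h])).symm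
    simp only [liftMatrix, partialKronecker, of_apply]
    rw [if_pos h0]
    have h1 : (∀ x : Fin d × Fin m, j.val ≤ x.1.val → (if x.1 = j then J x else I x) = J x) ↔
        ∀ x : Fin d × Fin m, j.val + 1 ≤ x.1.val → I x = J x := by
      constructor
      · intro h x hx
        have := h x (by omega)
        rwa [if_neg (by rintro rfl; omega)] at this
      · intro h x hx
        split_ifs with hxj
        · rfl
        · exact h x (by have : x.1.val ≠ j.val := fun h => hxj (Fin.ext h); omega)
    simp only [h1]
    have h2 : (fun x : Fin d × Fin m => if x.1 = j then J x else I x) ∘ blockEmb j =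
        J ∘ blockEmb j := by
      funext r; simp [blockEmb]
    have h3 : (Finset.univ.filter fun i : Fin d => i.val < j.val + 1) =
        insert j (Finset.univ.filter fun i : Fin d => i.val < j.val) := by
      ext i
      simp only [Finset.mem_filter, Finset.mem_univ, true_and, Finset.mem_insert, Fin.ext_iff]
      omega
    rw [h2, h3, Finset.prod_insert (by simp)]
    by_cases h4 : ∀ x : Fin d × Fin m, j.val + 1 ≤ x.1.val → I x = J x
    · rw [if_pos h4, if_pos h4]
      congr 1
      refine Finset.prod_congr rfl fun i hi => ?_
      have hij : i ≠ j := by rintro rfl; simp at hi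
      congr 1
      funext r; simp [blockEmb, hij]
    · rw [if_neg h4, if_neg h4, mul_zero]
  · intro K _ hK
    simp only [liftMatrix, partialKronecker, of_apply]
    rw [ite_zero_mul_ite_zero, if_neg]
    rintro ⟨h1, h2⟩
    refine hK (funext fun x => ?_)
    split_ifs with hx
    · exact h2 x (by rw [hx])
    · exact (h1 x fun r hr => hx (by rw [← hr]; rfl)).symm
  · simp

lemma commute_indexPermMatrix_partialKronecker
    (A : Matrix (Fin m → Fin n) (Fin m → Fin n) ℝ) {l : ℕ} (hl : l ≤ d)
    {π : Equiv.Perm (Fin d × Fin m)} (hπ : π ∈ permsOn (blocksFrom m d l)) :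
    Commute (indexPermMatrix n π) (partialKronecker A d l) := by
  induction l with
  | zero => rw [partialKronecker_zero]; exact Commute.one_right _
  | succ l ih =>
    rw [partialKronecker_succ A ⟨l, hl⟩]
    refine Commute.mul_right (commute_indexPermMatrix_liftMatrix (fun r => ?_) A) (ih (by omega) ?_)
    · refine mem_permsOn.1 hπ _ ?_
      simp [mem_blocksFrom, blockEmb]
    · refine permsOn_mono (fun x hx => ?_) hπ
      rw [mem_blocksFrom] at hx ⊢
      omega

lemma certificate_eq (A : Matrix (Fin m → Fin n) (Fin m → Fin n) ℝ) :
    certificate A d = symProj n Finset.univ * kroneckerPow A d * symProj n Finset.univ := by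
  have : permsOn (Finset.univ : Finset (Fin d × Fin m)) = Finset.univ := by
    ext π; simp [mem_permsOn]
  rw [certificate, symProj, symSum, this, Finset.card_univ, Matrix.smul_mul, Matrix.smul_mul,
    Matrix.mul_smul, smul_smul, sq, mul_inv, Finset.sum_mul, Finset.sum_mul_sum]

/-- The `j`-th factor of the certificate: `A` on block `j`, symmetrized on the right in the
positions not yet consumed and on the left in the positions already produced. -/
def blockFactor (A : Matrix (Fin m → Fin n) (Fin m → Fin n) ℝ) (j : Fin d) :
    Matrix (Fin d × Fin m → Fin n) (Fin d × Fin m → Fin n) ℝ :=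
  symProj n (blocksBefore m d (j.val + 1)) * liftMatrix (blockEmb j) A *
    symProj n (blocksFrom m d j.val)

lemma symProj_mul_partialKronecker_succ (A : Matrix (Fin m → Fin n) (Fin m → Fin n) ℝ)
    (j : Fin d) :
    symProj n (blocksBefore m d (j.val + 1)) * partialKronecker A d (j.val + 1) *
        symProj n Finset.univ =
      blockFactor A j *
        (symProj n (blocksBefore m d j.val) * partialKronecker A d j.val *
          symProj n Finset.univ) := by
  have hdisj : Disjoint (blocksFrom m d j.val) (blocksBefore m d j.val) := by
    rw [Finset.disjoint_left]
    intro x hx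
    rw [mem_blocksFrom] at hx
    rw [mem_blocksBefore]
    omega
  have hsub : blocksBefore m d j.val ⊆ blocksBefore m d (j.val + 1) := by
    intro x
    rw [mem_blocksBefore, mem_blocksBefore]
    omega
  have c1 := (commute_symProj_symProj (n := n) hdisj).eq
  have c2 : Commute (symProj n (blocksFrom m d j.val)) (partialKronecker A d j.val) :=
    commute_symProj fun π hπ => commute_indexPermMatrix_partialKronecker A j.2.le hπ
  have c3 : Commute (symProj n (blocksBefore m d j.val)) (liftMatrix (blockEmb j) A) :=
    commute_symProj_liftMatrix (fun r => by simp [mem_blocksBefore, blockEmb]) A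
  have a1 := symProj_mul_symProj_of_subset (n := n) (Finset.subset_univ (blocksFrom m d j.val))
  have a2 := symProj_mul_symProj_of_subset' (n := n) hsub
  symm
  rw [partialKronecker_succ, blockFactor]
  set Qs := symProj n (blocksBefore m d j.val)
  set Qs' := symProj n (blocksBefore m d (j.val + 1))
  set Qt := symProj n (blocksFrom m d j.val)
  set Qu := symProj n (Finset.univ : Finset (Fin d × Fin m))
  set K := partialKronecker A d j.val
  set E := liftMatrix (blockEmb j) A
  calc Qs' * E * Qt * (Qs * K * Qu) = Qs' * E * (Qt * Qs) * K * Qu := by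
        simp only [Matrix.mul_assoc]
    _ = Qs' * E * Qs * (Qt * K) * Qu := by rw [c1]; simp only [Matrix.mul_assoc]
    _ = Qs' * E * Qs * K * (Qt * Qu) := by rw [c2.eq]; simp only [Matrix.mul_assoc]
    _ = Qs' * (E * Qs) * K * Qu := by rw [a1]; simp only [Matrix.mul_assoc]
    _ = (Qs' * Qs) * E * K * Qu := by rw [← c3.eq]; simp only [Matrix.mul_assoc]
    _ = Qs' * (E * K) * Qu := by rw [a2]; simp only [Matrix.mul_assoc]

/-- The certificate is the product of its block factors, each of which is linear in the matrix. -/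
lemma norm_certificate_le (A : Matrix (Fin m → Fin n) (Fin m → Fin n) ℝ) {b : Fin d → ℝ}
    (hb : ∀ j, ‖blockFactor A j‖ ≤ b j) : ‖certificate A d‖ ≤ ∏ j, b j := by
  have hb0 : ∀ j, 0 ≤ b j := fun j => (norm_nonneg _).trans (hb j)
  have key : ∀ l, l ≤ d → ‖symProj n (blocksBefore m d l) * partialKronecker A d l *
      symProj n Finset.univ‖ ≤ ∏ j ∈ Finset.univ.filter (fun j : Fin d => j.val < l), b j := by
    intro l
    induction l with
    | zero =>
      intro _
      have : blocksBefore m d 0 = ∅ := by ext x; simp [mem_blocksBefore]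
      rw [this, symProj_empty, partialKronecker_zero, Matrix.one_mul, Matrix.one_mul]
      simpa using norm_symProj_le (n := n) (Finset.univ : Finset (Fin d × Fin m))
    | succ l ih =>
      intro hl
      have h3 : (Finset.univ.filter fun i : Fin d => i.val < l + 1) =
          insert ⟨l, hl⟩ (Finset.univ.filter fun i : Fin d => i.val < l) := by
        ext i
        simp only [Finset.mem_filter, Finset.mem_univ, true_and, Finset.mem_insert, Fin.ext_iff]
        omega
      rw [h3, Finset.prod_insert (by simp), symProj_mul_partialKronecker_succ A ⟨l, hl⟩]
      exact (norm_mul_le _ _).trans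
        (mul_le_mul (hb _) (ih (by omega)) (norm_nonneg _) (hb0 _))
  have h := key d le_rfl
  rw [Finset.filter_true_of_mem fun j _ => j.2, partialKronecker_self] at h
  have hu : blocksBefore m d d = Finset.univ := by ext x; simp [mem_blocksBefore]
  rwa [hu, ← certificate_eq] at h

lemma traceFactor_nonneg {a : ℕ} (ha : 1 ≤ a) : 0 ≤ traceFactor n m (a * m) := by
  refine Finset.prod_nonneg fun i hi => ?_
  rw [Finset.mem_range] at hi
  have h : (i : ℝ) + 1 ≤ m := by exact_mod_cast hi
  have ha' : (1 : ℝ) ≤ a := by exact_mod_cast ha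
  have h1 : (m : ℝ) ≤ a * m := by nlinarith
  push_cast
  apply div_nonneg <;> nlinarith [Nat.cast_nonneg (α := ℝ) n]

/-- Each factor is at most `2n / a`, because `q - i = a m - i ≥ a (m - i) ≥ a`. -/
lemma traceFactor_le {a : ℕ} (ha : 1 ≤ a) (han : a * m ≤ n) {y : ℝ} (hy : 2 * n / a ≤ y) :
    traceFactor n m (a * m) ≤ y ^ m := by
  have ha' : (1 : ℝ) ≤ a := by exact_mod_cast ha
  have han' : (a : ℝ) * m ≤ n := by exact_mod_cast han
  rw [traceFactor, ← Finset.card_range m, ← Finset.prod_const, Finset.card_range]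
  refine Finset.prod_le_prod (fun i hi => ?_) fun i hi => ?_
  all_goals
    rw [Finset.mem_range] at hi
    have h : (i : ℝ) + 1 ≤ m := by exact_mod_cast hi
    have hi0 : (0 : ℝ) ≤ i := Nat.cast_nonneg i
    have h1 : (m : ℝ) ≤ a * m := by nlinarith
    push_cast
  · apply div_nonneg <;> nlinarith [Nat.cast_nonneg (α := ℝ) n]
  · refine le_trans (div_le_div₀ (by positivity) ?_ (by linarith) ?_) hy
    · linarith
    · nlinarith

/-- The common variance bound of the two sides of the `j`-th block factor. The two sides have
`(2n / (j + 1)) ^ m` and `(2n / (d - j)) ^ m`; both are at most this product form because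
`(j + 1) + (d - j) = d + 1`. -/
def blockVariance (n m d : ℕ) (j : Fin d) : ℝ :=
  (2 * n * (d + 1) / ((j.val + 1) * (d - j.val : ℝ))) ^ m

/-- The Khintchine tail bound for the `j`-th block factor of a signed tensor. -/
lemma card_signs_blockFactor_le (hn : d * m ≤ n) (j : Fin d) (q : (Fin (m + m) → Fin n) → Prop)
    [DecidablePred q] {L : ℝ} {w : {S // q S} → ℝ} (hw : ∀ i, w i ^ 2 ≤ L ^ 2) (p : ℕ)
    (hp : p ≠ 0) {u : ℝ} (hu : 0 ≤ u) (T : ({S // q S} → ℤˣ) → Tensor n (m + m))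
    (hT : ∀ ε i, T ε i.1 = (ε i : ℤ) * w i) (hT' : ∀ ε S, ¬ q S → T ε S = 0) :
    ((Finset.univ.filter fun ε : {S // q S} → ℤˣ =>
      u < ‖blockFactor (flatten (T ε)) j‖).card : ℝ) * u ^ (2 * p) ≤
      (2 * p * (L ^ 2 * blockVariance n m d j)) ^ p *
        (Fintype.card ({S // q S} → ℤˣ) * (2 * (n : ℝ) ^ (d * m))) := by
  have hsum : ∀ ε, blockFactor (flatten (T ε)) j = signSum (fun i : {S // q S} =>
      w i • entryTerm (n := n) (blockEmb j) (blocksBefore m d (j.val + 1))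
        (blocksFrom m d j.val) i.1) ε := by
    intro ε
    rw [blockFactor, symProj_mul_liftMatrix_flatten, signSum,
      ← Fintype.sum_subtype_add_sum_subtype q]
    rw [Finset.sum_eq_zero (s := (Finset.univ : Finset {S // ¬ q S})) fun i _ => by
      rw [hT' ε i.1 i.2, zero_smul], add_zero]
    exact Finset.sum_congr rfl fun i _ => by rw [hT, smul_smul]
  simp only [hsum]
  have hcs : (blocksBefore m d (j.val + 1)).card = (j.val + 1) * m := card_blocksBefore j.2
  have hct : (blocksFrom m d j.val).card = (d - j.val) * m := card_blocksFrom j.2.le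
  have hj1 : (j.val : ℝ) + 1 ≤ d := by exact_mod_cast j.2
  have hj0 : (0 : ℝ) ≤ j.val := Nat.cast_nonneg _
  have hn0 : (0 : ℝ) ≤ n := Nat.cast_nonneg _
  have key := card_signs_entryTerm_le (n := n) (blockEmb_injective (m := m) j)
    (s := blocksBefore m d (j.val + 1)) (t := blocksFrom m d j.val)
    (fun r => by simp [mem_blocksBefore, blockEmb]) (fun r => by simp [mem_blocksFrom, blockEmb])
    (by
      rw [Finset.disjoint_left]
      intro x hx hx'
      rw [mem_blocksBefore] at hx
      rw [Finset.mem_sdiff, mem_blocksFrom] at hx'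
      exact hx'.2 (Finset.mem_image.2 ⟨x.2, Finset.mem_univ _,
        Prod.ext (Fin.ext (show j.val = x.1.val by omega)) rfl⟩))
    (by
      rw [Finset.disjoint_left]
      intro x hx hx'
      rw [mem_blocksFrom] at hx
      rw [Finset.mem_sdiff, mem_blocksBefore] at hx'
      exact hx'.2 (Finset.mem_image.2 ⟨x.2, Finset.mem_univ _,
        Prod.ext (Fin.ext (show j.val = x.1.val by omega)) rfl⟩))
    q (c := blockVariance n m d j) (L := L) (w := w)
    (by rw [hcs]; exact traceFactor_nonneg (by omega))
    (by rw [hct]; exact traceFactor_nonneg (by have := j.2; omega))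
    (by
      rw [hcs]
      refine traceFactor_le (by omega) ((Nat.mul_le_mul_right m j.2).trans hn) ?_
      push_cast
      rw [div_le_div_iff₀ (by linarith) (by nlinarith)]
      have : 0 ≤ 2 * (n : ℝ) * (j.val + 1) := by positivity
      nlinarith)
    (by
      rw [hct]
      refine traceFactor_le (by have := j.2; omega)
        ((Nat.mul_le_mul_right m (Nat.sub_le _ _)).trans hn) ?_
      rw [Nat.cast_sub j.2.le, div_le_div_iff₀ (by linarith) (by nlinarith)]
      have : 0 ≤ 2 * (n : ℝ) * (d - j.val) := mul_nonneg (by positivity) (by linarith)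
      nlinarith)
    hw p hp hu
  simpa [Fintype.card_prod] using key

end Blocks

/-! ### Sign-invariant laws -/

noncomputable section SignInvariance

variable {κ : Type} [Fintype κ] [DecidableEq κ]

/-- The coordinatewise action of signs on vectors. -/
def signAct (ε : κ → ℤˣ) (x : κ → ℝ) : κ → ℝ := fun i => ((ε i : ℤ) : ℝ) * x i

omit [DecidableEq κ] in
lemma map_signAct_eq {Ω : Type*} [MeasurableSpace Ω] {μ : Measure Ω} [IsProbabilityMeasure μ]
    {Z : κ → Ω → ℝ} (hZ : ∀ i, Measurable (Z i)) (hindep : iIndepFun Z μ)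
    (hsymm : ∀ i, IdentDistrib (Z i) (fun ω => -Z i ω) μ μ) (ε : κ → ℤˣ) :
    Measure.map (signAct ε) (Measure.map (fun ω i => Z i ω) μ) =
      Measure.map (fun ω i => Z i ω) μ := by
  have hp : ∀ i, IsProbabilityMeasure (Measure.map (Z i) μ) := fun i =>
    Measure.isProbabilityMeasure_map (hZ i).aemeasurable
  rw [(iIndepFun_iff_map_fun_eq_pi_map fun i => (hZ i).aemeasurable).1 hindep]
  have h1 : ∀ i, Measure.map (fun y : ℝ => ((ε i : ℤ) : ℝ) * y) (Measure.map (Z i) μ) =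
      Measure.map (Z i) μ := by
    intro i
    rw [Measure.map_map (by fun_prop) (hZ i)]
    rcases Int.units_eq_one_or (ε i) with h | h
    · congr 1; funext ω; simp [h]
    · rw [(hsymm i).map_eq]
      congr 1; funext ω; simp [h]
  have hp' : ∀ i, SigmaFinite (Measure.map (fun y : ℝ => ((ε i : ℤ) : ℝ) * y)
      (Measure.map (Z i) μ)) := fun i => by rw [h1]; infer_instance
  have := Measure.pi_map_pi (μ := fun i => Measure.map (Z i) μ)
    (f := fun i (y : ℝ) => ((ε i : ℤ) : ℝ) * y) (fun i => by fun_prop)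
  simp only [h1] at this
  exact this

/-- For a sign-invariant law, the measure of an event is at most the largest proportion of signs
that move a given vector into it. -/
lemma measure_le_of_card_signs_le {ν : Measure (κ → ℝ)} [IsProbabilityMeasure ν]
    (hν : ∀ ε, Measure.map (signAct ε) ν = ν) {s : Set (κ → ℝ)} (hs : MeasurableSet s) {δ : ℝ}
    (hδ : ∀ x, ({ε : κ → ℤˣ | signAct ε x ∈ s}.ncard : ℝ) ≤ δ * Nat.card (κ → ℤˣ)) :
    ν s ≤ ENNReal.ofReal δ := by
  classical
  simp only [Nat.card_eq_fintype_card] at hδ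
  have hmeas : ∀ ε : κ → ℤˣ, Measurable (signAct ε) := fun ε => by unfold signAct; fun_prop
  have h1 : ∀ ε : κ → ℤˣ, ν s = ∫⁻ x, s.indicator 1 (signAct ε x) ∂ν := by
    intro ε
    rw [← lintegral_map (f := s.indicator 1) (measurable_one.indicator hs) (hmeas ε), hν,
      lintegral_indicator_one hs]
  have h2 : (Fintype.card (κ → ℤˣ) : ENNReal) * ν s =
      ∫⁻ x, ∑ ε : κ → ℤˣ, s.indicator 1 (signAct ε x) ∂ν := by
    have hind : ∀ ε : κ → ℤˣ, Measurable fun x =>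
        s.indicator (1 : (κ → ℝ) → ENNReal) (signAct ε x) :=
      fun ε => (measurable_one.indicator hs).comp (hmeas ε)
    rw [lintegral_finsetSum _ fun ε _ => hind ε, ← Finset.sum_congr rfl fun ε _ => h1 ε,
      Finset.sum_const, Finset.card_univ, nsmul_eq_mul]
  have h3 : ∀ x, ∑ ε : κ → ℤˣ, s.indicator (1 : (κ → ℝ) → ENNReal) (signAct ε x) ≤
      ENNReal.ofReal (δ * Fintype.card (κ → ℤˣ)) := by
    intro x
    have : ∑ ε : κ → ℤˣ, s.indicator (1 : (κ → ℝ) → ENNReal) (signAct ε x) =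
        ({ε : κ → ℤˣ | signAct ε x ∈ s}.ncard : ENNReal) := by
      rw [Set.ncard_eq_toFinset_card', Finset.card_eq_sum_ones, Nat.cast_sum, Set.toFinset_ofPred,
        Finset.sum_filter]
      refine Finset.sum_congr rfl fun ε _ => ?_
      by_cases h : signAct ε x ∈ s <;> simp [h]
    rw [this, ← ENNReal.ofReal_natCast]
    exact ENNReal.ofReal_le_ofReal (hδ x)
  have hcard : (0 : ℝ) < Fintype.card (κ → ℤˣ) := by exact_mod_cast Fintype.card_pos
  have h4 : (Fintype.card (κ → ℤˣ) : ENNReal) * ν s ≤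
      Fintype.card (κ → ℤˣ) * ENNReal.ofReal δ := by
    rw [h2]
    refine (lintegral_mono h3).trans ?_
    rw [lintegral_const, measure_univ, mul_one, mul_comm, ENNReal.ofReal_mul hcard.le,
      ENNReal.ofReal_natCast]
  exact (ENNReal.mul_le_mul_iff_right (by exact_mod_cast hcard.ne') (ENNReal.natCast_ne_top _)).1 h4

end SignInvariance

/-! ### Tails of subgaussian variables -/

noncomputable section Tail

lemma hasSubgaussianMGF_mono {Ω : Type*} [MeasurableSpace Ω] {μ : Measure Ω} {X : Ω → ℝ}
    {v w : ℝ≥0} (h : HasSubgaussianMGF X v μ) (hvw : v ≤ w) : HasSubgaussianMGF X w μ :=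
  ⟨h.integrable_exp_mul, fun t => (h.mgf_le t).trans <| Real.exp_le_exp.2 <| by
    have : (v : ℝ) ≤ w := hvw
    gcongr⟩

/-- The variance proxy is enlarged to `v + 1` so that the bound is meaningful for `v = 0`. -/
lemma measure_abs_gt_le {Ω : Type*} [MeasurableSpace Ω] {μ : Measure Ω} [IsProbabilityMeasure μ]
    {X : Ω → ℝ} {v : ℝ≥0} (h : HasSubgaussianMGF X v μ) {r : ℝ} (hr : 0 ≤ r) :
    μ {ω | r < |X ω|} ≤ ENNReal.ofReal (2 * Real.exp (-r ^ 2 / (2 * (v + 1)))) := by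
  have h' := hasSubgaussianMGF_mono h (le_add_of_nonneg_right zero_le_one : v ≤ v + 1)
  have h1 := h'.measure_ge_le hr
  have h2 := h'.neg.measure_ge_le hr
  have hsub : {ω | r < |X ω|} ⊆ {ω | r ≤ X ω} ∪ {ω | r ≤ (-X) ω} := by
    intro ω hω
    rcases lt_abs.1 (show r < |X ω| from hω) with h | h
    · exact Or.inl h.le
    · exact Or.inr h.le
  rw [← ofReal_measureReal]
  refine ENNReal.ofReal_le_ofReal
    ((measureReal_mono hsub).trans ((measureReal_union_le _ _).trans ?_))
  push_cast at h1 h2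
  linarith

end Tail

/-! ### The certificate of a random tensor -/

noncomputable section FixedDimension

open Matrix
open scoped Matrix.Norms.L2Operator

variable {n m d : ℕ}

open Classical in
/-- The asymmetric tensor with the entries `k! x_S` on the lexicographically first tuples. -/
def tensorOfEntries {k : ℕ} (x : {S : Fin k → Fin n // IsLexFirst S} → ℝ) : Tensor n k := fun S =>
  if h : IsLexFirst S then (k.factorial : ℝ) * x ⟨S, h⟩ else 0

lemma asymmetrize_eq_tensorOfEntries {k : ℕ} {T : Tensor n k}
    (hT : ∀ S, ∀ π : Equiv.Perm (Fin k), T (S ∘ π) = T S) :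
    asymmetrize T = tensorOfEntries fun i => T i.1 := by
  funext S
  simp only [asymmetrize, tensorOfEntries, hT, Finset.sum_const, Finset.card_univ,
    Fintype.card_perm, Fintype.card_fin, nsmul_eq_mul]
  split_ifs <;> rfl

lemma measurable_norm_blockFactor (j : Fin d) :
    Measurable fun x : {S : Fin (m + m) → Fin n // IsLexFirst S} → ℝ =>
      ‖blockFactor (flatten (tensorOfEntries x)) j‖ := by
  refine Continuous.measurable (continuous_norm.comp ?_)
  simp only [blockFactor, symProj_mul_liftMatrix_flatten]
  refine continuous_finsetSum _ fun S _ => Continuous.fun_smul ?_ continuous_const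
  unfold tensorOfEntries
  split_ifs <;> fun_prop

/-- The norm that the `j`-th block factor exceeds with small probability when all entries of the
symmetric tensor are at most `log n` in absolute value: `e` times the `2p`-th moment bound of the
Khintchine inequality, with `p = ⌈dm log n⌉`. -/
def blockThreshold (n m d : ℕ) (j : Fin d) : ℝ :=
  Real.sqrt (Real.exp 2 * (2 * ⌈(d * m : ℕ) * Real.log n⌉₊) *
    (((m + m).factorial : ℝ) * Real.log n) ^ 2 * blockVariance n m d j)

lemma blockVariance_pos (hn : 0 < n) (j : Fin d) : 0 < blockVariance n m d j := by
  have h1 : (j.val : ℝ) + 1 ≤ d := by exact_mod_cast j.2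
  have h2 : (0 : ℝ) < n := by exact_mod_cast hn
  have h3 : (0 : ℝ) < d - j.val := by linarith
  unfold blockVariance
  positivity

/-- At the chosen moment the tail bound `e^{-2p}` outweighs the dimension `2 n^(dm)`. -/
lemma card_signs_blockThreshold_le (hlog : 1 ≤ Real.log n) (hm : 1 ≤ m) (hdm : d * m ≤ n)
    (j : Fin d) {x : {S : Fin (m + m) → Fin n // IsLexFirst S} → ℝ}
    (hx : ∀ i, |x i| ≤ Real.log n) :
    ({ε : {S : Fin (m + m) → Fin n // IsLexFirst S} → ℤˣ |
      blockThreshold n m d j < ‖blockFactor (flatten (tensorOfEntries (signAct ε x))) j‖}.ncard : ℝ)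
      ≤ 2 / (n : ℝ) ^ (d * m) *
        Nat.card ({S : Fin (m + m) → Fin n // IsLexFirst S} → ℤˣ) := by
  classical
  rw [Nat.card_eq_fintype_card]
  have hn : 0 < n := by
    rcases Nat.eq_zero_or_pos n with rfl | h
    · simp at hlog; linarith
    · exact h
  have hn' : (0 : ℝ) < n := by exact_mod_cast hn
  have hd : 0 < d := j.pos
  have hD : 0 < d * m := Nat.mul_pos hd hm
  have hD' : (0 : ℝ) < (d * m : ℕ) := by exact_mod_cast hD
  -- The moment `2 * p` is of the order of the logarithm of the dimension `n ^ (d * m)`.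
  set p := ⌈(d * m : ℕ) * Real.log n⌉₊ with hp
  have hp0 : 0 < p := Nat.ceil_pos.2 (by positivity)
  have hp0' : (0 : ℝ) < p := by exact_mod_cast hp0
  have hV := blockVariance_pos (m := m) hn j
  set L : ℝ := ((m + m).factorial : ℝ) * Real.log n with hL
  have hL0 : 0 < L := by positivity
  have key := card_signs_blockFactor_le hdm j IsLexFirst (L := L)
    (w := fun i => ((m + m).factorial : ℝ) * x i)
    (fun i => by
      rw [sq_le_sq, abs_mul, abs_of_pos hL0, Nat.abs_cast]
      exact mul_le_mul_of_nonneg_left (hx i) (by positivity)) p hp0.ne'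
    (u := blockThreshold n m d j) (Real.sqrt_nonneg _)
    (fun ε => tensorOfEntries (signAct ε x))
    (fun ε i => by
      rw [tensorOfEntries, dif_pos i.2, signAct]; ring)
    (fun ε S hS => by rw [tensorOfEntries, dif_neg hS])
  have hu : blockThreshold n m d j ^ (2 * p) =
      Real.exp (2 * p) * (2 * p * (L ^ 2 * blockVariance n m d j)) ^ p := by
    rw [pow_mul, blockThreshold, Real.sq_sqrt (by positivity), mul_comm 2 (p : ℝ), Real.exp_nat_mul,
      ← mul_pow]
    congr 1
    ring
  have hexp : (n : ℝ) ^ (d * m) * (n : ℝ) ^ (d * m) ≤ Real.exp (2 * p) := by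
    rw [two_mul, Real.exp_add]
    have : (n : ℝ) ^ (d * m) ≤ Real.exp p := by
      rw [← Real.exp_log hn', ← Real.exp_nat_mul]
      exact Real.exp_le_exp.2 (Nat.le_ceil _)
    gcongr
  rw [Set.ncard_eq_toFinset_card', Set.toFinset_ofPred]
  rw [hu, ← mul_assoc, mul_comm _ (_ ^ p)] at key
  have key2 := le_of_mul_le_mul_left key (by positivity)
  have hN : (0 : ℝ) < (n : ℝ) ^ (d * m) := by positivity
  rw [div_mul_eq_mul_div, le_div_iff₀ hN]
  set X := ((Finset.univ.filter fun ε : {S : Fin (m + m) → Fin n // IsLexFirst S} → ℤˣ =>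
    blockThreshold n m d j < ‖blockFactor (flatten (tensorOfEntries (signAct ε x))) j‖).card : ℝ)
  have hX : 0 ≤ X := Nat.cast_nonneg _
  have key3 := (mul_le_mul_of_nonneg_left hexp hX).trans key2
  refine le_of_mul_le_mul_right ?_ hN
  calc X * (n : ℝ) ^ (d * m) * (n : ℝ) ^ (d * m) = X * ((n : ℝ) ^ (d * m) * (n : ℝ) ^ (d * m)) := by
        ring
    _ ≤ _ := key3
    _ = _ := by ring

/-- With probability `1 - O(1 / n)` the norm of the certificate is at most the product of the
thresholds of its block factors. -/
lemma measure_prod_blockThreshold_lt_opNorm_le {Ω : Type*} [MeasurableSpace Ω] {μ : Measure Ω}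
    [IsProbabilityMeasure μ] {v : ℝ≥0} {T : Ω → Tensor n (m + m)}
    (hT : IsRandomSymmetricTensor μ v T) (hlog : 1 ≤ Real.log n) (hm : 1 ≤ m) (hd : 1 ≤ d)
    (hdm : d * m ≤ n) (hk : 8 * ((v : ℝ) + 1) * ((m + m : ℕ) : ℝ) ≤ Real.log n) :
    μ {ω | ∏ j, blockThreshold n m d j < opNorm (certificate (flatten (asymmetrize (T ω))) d)} ≤
      ENNReal.ofReal (4 / n) := by
  classical
  have hn : 0 < n := by
    rcases Nat.eq_zero_or_pos n with rfl | h
    · simp at hlog; linarith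
    · exact h
  have hn' : (0 : ℝ) < n := by exact_mod_cast hn
  have hn2 : 2 ≤ n := by
    by_contra h
    have : n = 1 := by omega
    subst this; simp at hlog; linarith
  set κ := {S : Fin (m + m) → Fin n // IsLexFirst S}
  set Z : κ → Ω → ℝ := fun i ω => T ω i.1 with hZdef
  have hZ : ∀ i, Measurable (Z i) := fun i => hT.measurable i.1
  have hZ' : Measurable fun ω i => Z i ω := measurable_pi_lambda _ hZ
  set ν := Measure.map (fun ω i => Z i ω) μ
  have : IsProbabilityMeasure ν := Measure.isProbabilityMeasure_map hZ'.aemeasurable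
  set bad : Set (κ → ℝ) := {x | (∀ i, |x i| ≤ Real.log n) ∧
    ∃ j : Fin d, blockThreshold n m d j < ‖blockFactor (flatten (tensorOfEntries x)) j‖} with hbad
  have hbadm : MeasurableSet bad := by
    refine MeasurableSet.inter (s₁ := {x : κ → ℝ | ∀ i, |x i| ≤ Real.log n})
      (s₂ := {x : κ → ℝ | ∃ j : Fin d, blockThreshold n m d j <
        ‖blockFactor (flatten (tensorOfEntries x)) j‖}) ?_ ?_
    · rw [Set.ofPred_forall]
      exact MeasurableSet.iInter fun i =>
        measurableSet_le (measurable_pi_apply i).abs measurable_const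
    · rw [Set.ofPred_exists]
      exact MeasurableSet.iUnion fun j =>
        measurableSet_lt measurable_const (measurable_norm_blockFactor j)
  have hcount : ∀ x, ({ε : κ → ℤˣ | signAct ε x ∈ bad}.ncard : ℝ) ≤
      2 / n * Nat.card (κ → ℤˣ) := by
    intro x
    by_cases hx : ∀ i, |x i| ≤ Real.log n
    · -- A union bound over the `d` blocks costs a factor `d ≤ n ^ (d - 1)`.
      have hsub : {ε : κ → ℤˣ | signAct ε x ∈ bad} ⊆ ⋃ j : Fin d, {ε : κ → ℤˣ |
          blockThreshold n m d j <
            ‖blockFactor (flatten (tensorOfEntries (signAct ε x))) j‖} := by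
        rintro ε ⟨_, j, hj⟩
        exact Set.mem_iUnion.2 ⟨j, hj⟩
      have h1 : ({ε : κ → ℤˣ | signAct ε x ∈ bad}.ncard : ℝ) ≤ ∑ j : Fin d,
          ({ε : κ → ℤˣ | blockThreshold n m d j <
            ‖blockFactor (flatten (tensorOfEntries (signAct ε x))) j‖}.ncard : ℝ) := by
        refine (Nat.cast_le.2 (Set.ncard_le_ncard hsub (Set.toFinite _))).trans ?_
        have := Finset.set_ncard_biUnion_le Finset.univ fun j : Fin d => {ε : κ → ℤˣ |
          blockThreshold n m d j < ‖blockFactor (flatten (tensorOfEntries (signAct ε x))) j‖}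
        simp only [Finset.mem_univ, Set.iUnion_true] at this
        exact_mod_cast this
      refine h1.trans ((Finset.sum_le_sum fun j _ =>
        card_signs_blockThreshold_le hlog hm hdm j hx).trans ?_)
      rw [Finset.sum_const, Finset.card_univ, Fintype.card_fin, nsmul_eq_mul, ← mul_assoc]
      refine mul_le_mul_of_nonneg_right ?_ (Nat.cast_nonneg _)
      have hdn : (d : ℝ) * n ≤ (n : ℝ) ^ (d * m) := by
        have h2 : d ≤ n ^ (d - 1) := by
          calc d = (d - 1) + 1 := by omega
            _ ≤ 2 ^ (d - 1) := Nat.lt_two_pow_self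
            _ ≤ n ^ (d - 1) := Nat.pow_le_pow_left hn2 _
        have h3 : d * n ≤ n ^ (d * m) := by
          calc d * n ≤ n ^ (d - 1) * n := Nat.mul_le_mul_right n h2
            _ = n ^ d := by rw [← pow_succ, Nat.sub_add_cancel hd]
            _ ≤ n ^ (d * m) := Nat.pow_le_pow_right hn (Nat.le_mul_of_pos_right d hm)
        exact_mod_cast h3
      rw [← mul_div_assoc, div_le_div_iff₀ (by positivity) hn']
      nlinarith
    · have : {ε : κ → ℤˣ | signAct ε x ∈ bad} = ∅ := by
        rw [Set.eq_empty_iff_forall_notMem]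
        rintro ε ⟨h, _⟩
        refine hx fun i => ?_
        have h1 := h i
        rw [signAct, abs_mul] at h1
        have h2 : |((ε i : ℤ) : ℝ)| = 1 := by
          rcases Int.units_eq_one_or (ε i) with h | h <;> simp [h]
        rwa [h2, one_mul] at h1
      rw [this, Set.ncard_empty, Nat.cast_zero]
      positivity
  have hν := measure_le_of_card_signs_le
    (map_signAct_eq hZ hT.independent fun i => hT.symmetricLaw i.1) hbadm hcount
  rw [Measure.map_apply hZ' hbadm] at hν
  -- There are at most `n ^ k` entries, and `k ≤ log n / (8 (v + 1))`.
  have htail : μ (⋃ i : κ, {ω | Real.log n < |Z i ω|}) ≤ ENNReal.ofReal (2 / n) := by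
    refine (measure_iUnion_fintype_le _ _).trans ((Finset.sum_le_sum fun i _ =>
      measure_abs_gt_le (hT.subgaussian i.1) (by linarith)).trans ?_)
    rw [Finset.sum_const, Finset.card_univ, nsmul_eq_mul, ← ENNReal.ofReal_natCast,
      ← ENNReal.ofReal_mul (Nat.cast_nonneg _)]
    refine ENNReal.ofReal_le_ofReal ?_
    have hcard : (Fintype.card κ : ℝ) ≤ Real.exp (((m + m : ℕ) : ℝ) * Real.log n) := by
      rw [Real.exp_nat_mul, Real.exp_log hn']
      have := Fintype.card_subtype_le (fun S : Fin (m + m) → Fin n => IsLexFirst S)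
      rw [Fintype.card_fun, Fintype.card_fin, Fintype.card_fin] at this
      exact_mod_cast this
    have hv : (0 : ℝ) ≤ v := v.2
    calc (Fintype.card κ : ℝ) * (2 * Real.exp (-Real.log n ^ 2 / (2 * (v + 1))))
        ≤ Real.exp (((m + m : ℕ) : ℝ) * Real.log n) *
          (2 * Real.exp (-Real.log n ^ 2 / (2 * (v + 1)))) := by gcongr
      _ = 2 * Real.exp (((m + m : ℕ) : ℝ) * Real.log n + -Real.log n ^ 2 / (2 * (v + 1))) := by
        rw [Real.exp_add]; ring
      _ ≤ 2 * Real.exp (-Real.log n) := by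
        gcongr
        have hm' : (1 : ℝ) ≤ ((m + m : ℕ) : ℝ) := by exact_mod_cast (by omega : 1 ≤ m + m)
        have h1 : 4 * ((m + m : ℕ) : ℝ) * Real.log n ≤ Real.log n ^ 2 / (2 * (v + 1)) := by
          rw [le_div_iff₀ (by linarith)]
          nlinarith
        rw [neg_div]
        nlinarith
      _ = 2 / n := by rw [Real.exp_neg, Real.exp_log hn']; rfl
  have hsub : {ω | ∏ j, blockThreshold n m d j <
      opNorm (certificate (flatten (asymmetrize (T ω))) d)} ⊆
      (⋃ i : κ, {ω | Real.log n < |Z i ω|}) ∪ (fun ω i => Z i ω) ⁻¹' bad := by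
    intro ω hω
    by_contra hcon
    simp only [Set.mem_union, Set.mem_iUnion, Set.mem_ofPred_eq, Set.mem_preimage, hbad, not_or,
      not_exists, not_lt, not_and] at hcon
    obtain ⟨h1, h2⟩ := hcon
    refine absurd (show ∏ j, blockThreshold n m d j < opNorm _ from hω) (not_lt.2 ?_)
    rw [asymmetrize_eq_tensorOfEntries (hT.symmetric ω)]
    exact norm_certificate_le _ (h2 h1)
  refine (measure_mono hsub).trans ((measure_union_le _ _).trans ((add_le_add htail hν).trans ?_))
  rw [← ENNReal.ofReal_add (by positivity) (by positivity)]
  refine ENNReal.ofReal_le_ofReal (le_of_eq ?_)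
  ring

end FixedDimension

/-! ### Numerical bounds and asymptotics -/

noncomputable section Numerics

variable {n m d : ℕ}

/-- The rising and falling factors of the block variances balance: both multiply to `d!`. -/
lemma prod_blockVariance_le (hd : 1 ≤ d) :
    ∏ j, blockVariance n m d j ≤ ((4 * Real.exp 2 * n / d) ^ d) ^ m := by
  have hd' : (1 : ℝ) ≤ d := by exact_mod_cast hd
  have hdp : (0 : ℝ) < d := by linarith
  have h1 : ∏ j : Fin d, ((j.val : ℝ) + 1) = d.factorial := by
    rw [Fin.prod_univ_eq_prod_range (fun i => (i : ℝ) + 1) d,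
      ← Finset.prod_range_add_one_eq_factorial]
    push_cast
    rfl
  have h2 : ∏ j : Fin d, ((d : ℝ) - j.val) = d.factorial := by
    rw [← h1, ← Equiv.prod_comp Fin.revPerm]
    refine Finset.prod_congr rfl fun j _ => ?_
    rw [Fin.revPerm_apply, Fin.val_rev, Nat.cast_sub j.2]
    push_cast
    ring
  have hfac : (d : ℝ) ^ d ≤ Real.exp 1 ^ d * d.factorial := by
    rw [← Real.exp_nat_mul, mul_one, ← div_le_iff₀ (by positivity)]
    exact Real.pow_div_factorial_le_exp (d : ℝ) hdp.le d
  unfold blockVariance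
  rw [Finset.prod_pow]
  refine pow_le_pow_left₀ (Finset.prod_nonneg fun j _ => ?_) ?_ m
  · have : (j.val : ℝ) + 1 ≤ d := by exact_mod_cast j.2
    have h3 : (0 : ℝ) < d - j.val := by linarith
    positivity
  rw [Finset.prod_div_distrib, Finset.prod_const, Finset.card_univ, Fintype.card_fin,
    Finset.prod_mul_distrib, h1, h2, div_pow, div_le_div_iff₀ (by positivity) (by positivity)]
  have he : Real.exp 2 = Real.exp 1 * Real.exp 1 := by rw [← Real.exp_add]; norm_num
  calc (2 * (n : ℝ) * (d + 1)) ^ d * (d : ℝ) ^ d ≤ (2 * (n : ℝ) * (2 * d)) ^ d * (d : ℝ) ^ d := by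
        gcongr; linarith
    _ = (4 * (n : ℝ)) ^ d * ((d : ℝ) ^ d * (d : ℝ) ^ d) := by
        rw [← mul_pow, ← mul_pow, ← mul_pow]; congr 1; ring
    _ ≤ (4 * (n : ℝ)) ^ d * ((Real.exp 1 ^ d * d.factorial) * (Real.exp 1 ^ d * d.factorial)) := by
        gcongr
    _ = _ := by
        rw [he]
        simp only [mul_pow]
        ring

/-- The asserted bound, with `c = 10`, without the factor `d ^ (k² log d / (4 log n))`, which is at
least `1`. -/
def mainBound (n m d : ℕ) : ℝ :=
  (10 * Real.log n ^ 2) ^ (m + m) *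
    ((n : ℝ) ^ (((m + m : ℕ) : ℝ) / 4) / (d : ℝ) ^ ((((m + m : ℕ) : ℝ) - 2) / 4))

lemma mainBound_sq (hm : 1 ≤ m) : mainBound n m d ^ 2 =
    (10 * Real.log n ^ 2) ^ (4 * m) * ((n : ℝ) ^ m / (d : ℝ) ^ (m - 1)) := by
  rw [mainBound, mul_pow, ← pow_mul, div_pow, ← Real.rpow_natCast ((n : ℝ) ^ _),
    ← Real.rpow_mul (by positivity), ← Real.rpow_natCast ((d : ℝ) ^ _),
    ← Real.rpow_mul (by positivity),
    ← Real.rpow_natCast _ m, ← Real.rpow_natCast _ (m - 1), Nat.cast_sub hm]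
  congr 2
  · ring
  · congr 1
    push_cast; ring
  · congr 1
    push_cast; ring

lemma prod_blockThreshold_le (hlog : 1 ≤ Real.log n) (hm : 1 ≤ m) (hd : 1 ≤ d)
    (hk : ((m + m : ℕ) : ℝ) ≤ Real.log n) :
    ∏ j, blockThreshold n m d j ≤ mainBound n m d ^ d := by
  have hd' : (1 : ℝ) ≤ d := by exact_mod_cast hd
  have hm' : (1 : ℝ) ≤ m := by exact_mod_cast hm
  have hn : 0 < n := by
    rcases Nat.eq_zero_or_pos n with rfl | h
    · simp at hlog; linarith
    · exact h
  have hn' : (0 : ℝ) < n := by exact_mod_cast hn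
  set ℓ := Real.log n with hℓ
  have hV : ∀ j : Fin d, 0 ≤ blockVariance n m d j := fun j => (blockVariance_pos hn j).le
  have hbound0 : 0 ≤ mainBound n m d := by unfold mainBound; positivity
  set p := ⌈(d * m : ℕ) * ℓ⌉₊ with hp
  have hp1 : (2 * p : ℝ) ≤ 4 * (d * ℓ * ℓ) := by
    have h1 : (p : ℝ) ≤ (d * m : ℕ) * ℓ + 1 := (Nat.ceil_lt_add_one (by positivity)).le
    push_cast at h1 hk
    have h2 : (1 : ℝ) ≤ d * m * ℓ := by nlinarith [mul_le_mul hd' hm' zero_le_one (by linarith)]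
    have h3 : (d : ℝ) * m * ℓ ≤ d * ℓ * ℓ := by
      have : (m : ℝ) ≤ ℓ := by linarith
      gcongr
    linarith
  have hfac : ((m + m).factorial : ℝ) ≤ ℓ ^ (m + m) := by
    calc ((m + m).factorial : ℝ) ≤ ((m + m : ℕ) : ℝ) ^ (m + m) := by
          exact_mod_cast Nat.factorial_le_pow (m + m)
      _ ≤ ℓ ^ (m + m) := by gcongr
  have hexp : Real.exp 2 ≤ 8 := by
    have : Real.exp 2 = Real.exp 1 * Real.exp 1 := by rw [← Real.exp_add]; norm_num
    have h2 := Real.exp_one_lt_d9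
    have h3 := Real.exp_pos 1
    rw [this]
    nlinarith
  -- The part of the squared threshold that does not depend on the block.
  set X := Real.exp 2 * (2 * p) * (((m + m).factorial : ℝ) * ℓ) ^ 2 with hX
  have hX0 : 0 ≤ X := by positivity
  have hkey : X * (4 * Real.exp 2 * n / d) ^ m ≤ mainBound n m d ^ 2 := by
    rw [mainBound_sq hm]
    calc X * (4 * Real.exp 2 * n / d) ^ m
        ≤ (8 * (4 * (d * ℓ * ℓ)) * (ℓ ^ (m + m) * ℓ) ^ 2) * (4 * 8 * n / d) ^ m := by
          rw [hX]; gcongr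
      _ = 32 ^ (m + 1) * ℓ ^ (4 * m + 4) * (d * (n / d : ℝ) ^ m) := by
          rw [mul_div_assoc, mul_pow (4 * 8 : ℝ)]
          ring
      _ ≤ 10 ^ (4 * m) * ℓ ^ (8 * m) * (d * (n / d : ℝ) ^ m) := by
          have h1 : (32 : ℝ) ^ (m + 1) ≤ 10 ^ (4 * m) := by
            calc (32 : ℝ) ^ (m + 1) ≤ 32 ^ (2 * m) := pow_le_pow_right₀ (by norm_num) (by omega)
              _ = (32 ^ 2) ^ m := by rw [pow_mul]
              _ ≤ (10 ^ 4) ^ m := by gcongr; norm_num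
              _ = _ := by rw [pow_mul]
          have h2 : ℓ ^ (4 * m + 4) ≤ ℓ ^ (8 * m) := pow_le_pow_right₀ hlog (by omega)
          gcongr
      _ = (10 * ℓ ^ 2) ^ (4 * m) * ((n : ℝ) ^ m / (d : ℝ) ^ (m - 1)) := by
          obtain ⟨r, rfl⟩ : ∃ r, m = r + 1 := ⟨m - 1, by omega⟩
          rw [Nat.add_sub_cancel, div_pow, mul_pow, ← pow_mul, pow_succ (d : ℝ) r]
          field_simp
          ring
  have hsq : (∏ j, blockThreshold n m d j) ^ 2 ≤ (mainBound n m d ^ d) ^ 2 := by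
    calc (∏ j, blockThreshold n m d j) ^ 2 = ∏ j, (X * blockVariance n m d j) := by
          rw [← Finset.prod_pow]
          exact Finset.prod_congr rfl fun j _ => Real.sq_sqrt (mul_nonneg hX0 (hV j))
      _ = X ^ d * ∏ j, blockVariance n m d j := by
          rw [Finset.prod_mul_distrib, Finset.prod_const, Finset.card_univ, Fintype.card_fin]
      _ ≤ X ^ d * ((4 * Real.exp 2 * n / d) ^ d) ^ m := by
          gcongr; exact prod_blockVariance_le hd
      _ = (X * (4 * Real.exp 2 * n / d) ^ m) ^ d := by
          rw [mul_pow X, ← pow_mul, ← pow_mul, mul_comm d m]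
      _ ≤ (mainBound n m d ^ 2) ^ d := by gcongr
      _ = _ := by rw [← pow_mul, ← pow_mul, mul_comm]
  exact (sq_le_sq₀ (Finset.prod_nonneg fun j _ => Real.sqrt_nonneg _) (by positivity)).1 hsq

/-- A sequence `d ≥ 1` can be `o(n^{1/(3k²)})` only if `k² = o(log n)`. -/
lemma eventually_sq_le_log {k d : ℕ → ℕ} (hd : ∀ n, 1 ≤ d n) (hk : ∀ n, 2 ≤ k n)
    (h : (fun n => (d n : ℝ)) =o[atTop] fun n => (n : ℝ) ^ (1 / (3 * (k n : ℝ) ^ 2))) (C : ℝ) :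
    ∀ᶠ n : ℕ in atTop, C * (k n : ℝ) ^ 2 ≤ Real.log n := by
  filter_upwards [h.def (Real.exp_pos (-C)), eventually_ge_atTop 1] with n hn hn1
  have hn0 : (0 : ℝ) < n := by exact_mod_cast hn1
  have hk' : (2 : ℝ) ≤ k n := by exact_mod_cast hk n
  have hd' : (1 : ℝ) ≤ d n := by exact_mod_cast hd n
  rw [Real.norm_natCast, Real.norm_of_nonneg (by positivity), Real.exp_neg,
    Real.rpow_def_of_pos hn0, inv_mul_eq_div, le_div_iff₀ (Real.exp_pos _)] at hn
  have h1 : Real.exp C ≤ Real.exp (Real.log n * (1 / (3 * (k n : ℝ) ^ 2))) :=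
    le_trans (by nlinarith [Real.exp_pos C]) hn
  have h2 := Real.exp_le_exp.1 h1
  have hlog : 0 ≤ Real.log n := Real.log_nonneg (by exact_mod_cast hn1)
  rw [mul_one_div, le_div_iff₀ (by positivity)] at h2
  rcases le_total 0 C with hC | hC
  · have : 0 ≤ C * (k n : ℝ) ^ 2 := by positivity
    nlinarith
  · nlinarith [sq_nonneg (k n : ℝ)]

lemma eventually_mul_le {m d : ℕ → ℕ} (hd : ∀ n, 1 ≤ d n) (hm : ∀ n, 2 ≤ m n + m n)
    (h : (fun n => (d n : ℝ)) =o[atTop]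
      fun n => (n : ℝ) ^ (1 / (3 * ((m n + m n : ℕ) : ℝ) ^ 2))) :
    ∀ᶠ n : ℕ in atTop, d n * m n ≤ n := by
  filter_upwards [h.def one_pos, eventually_ge_atTop 1, eventually_sq_le_log hd hm h 1]
    with n hn hn1 hlog
  have hn0 : (1 : ℝ) ≤ n := by exact_mod_cast hn1
  have hk' : (2 : ℝ) ≤ ((m n + m n : ℕ) : ℝ) := by exact_mod_cast hm n
  rw [Real.norm_natCast, Real.norm_of_nonneg (by positivity), one_mul] at hn
  have h1 : (d n : ℝ) ≤ Real.sqrt n := by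
    rw [Real.sqrt_eq_rpow]
    refine hn.trans (Real.rpow_le_rpow_of_exponent_le hn0 ?_)
    rw [div_le_div_iff₀ (by positivity) (by norm_num)]
    nlinarith
  have h2 : (m n : ℝ) ≤ Real.sqrt n := by
    have h3 : Real.log n = 2 * Real.log (Real.sqrt n) := by
      rw [Real.log_sqrt (by positivity)]; ring
    have h4 := Real.log_le_sub_one_of_pos (Real.sqrt_pos.2 (by linarith : (0 : ℝ) < n))
    push_cast at hlog hk'
    nlinarith
  have h5 : (d n : ℝ) * m n ≤ n := by
    calc (d n : ℝ) * m n ≤ Real.sqrt n * Real.sqrt n := by gcongr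
      _ = n := Real.mul_self_sqrt (by positivity)
  exact_mod_cast h5

end Numerics

theorem mainTheorem5 :
    ∃ c : ℝ, 0 < c ∧
      ∀ (v : ℝ≥0) (k m d : ℕ → ℕ),
        (∀ n, k n = m n + m n) → (∀ n, 2 ≤ k n) → (∀ n, 1 ≤ d n) →
        (fun n => (d n : ℝ)) =o[atTop] (fun n => (n : ℝ) ^ (1 / (3 * (k n : ℝ) ^ 2))) →
        ∀ (Ω : ℕ → Type*) [∀ n, MeasurableSpace (Ω n)] (μ : ∀ n, Measure (Ω n))
          [∀ n, IsProbabilityMeasure (μ n)] (T : ∀ n, Ω n → Tensor n (m n + m n)),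
          (∀ n, IsRandomSymmetricTensor (μ n) v (T n)) →
          Tendsto
            (fun n => μ n {ω |
              opNorm (certificate (flatten (asymmetrize (T n ω))) (d n)) ^ (1 / (d n : ℝ)) ≤
                (c * Real.log n ^ 2) ^ (k n) *
                  (d n : ℝ) ^ ((k n : ℝ) ^ 2 * Real.log (d n) / (4 * Real.log n)) *
                  ((n : ℝ) ^ ((k n : ℝ) / 4) / (d n : ℝ) ^ (((k n : ℝ) - 2) / 4))})
            atTop (𝓝 1) := by
  refine ⟨10, by norm_num, fun v k m d hkm hk hd ho Ω _ μ _ T hT => ?_⟩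
  obtain rfl : k = fun n => m n + m n := funext hkm
  have hm : ∀ n, 1 ≤ m n := fun n => by have := hk n; simp only at this; omega
  set good : ∀ n, Set (Ω n) := fun n => {ω |
    opNorm (certificate (flatten (asymmetrize (T n ω))) (d n)) ^ (1 / (d n : ℝ)) ≤
      (10 * Real.log n ^ 2) ^ (m n + m n) *
        (d n : ℝ) ^ (((m n + m n : ℕ) : ℝ) ^ 2 * Real.log (d n) / (4 * Real.log n)) *
        ((n : ℝ) ^ (((m n + m n : ℕ) : ℝ) / 4) / (d n : ℝ) ^ ((((m n + m n : ℕ) : ℝ) - 2) / 4))}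
    with hgood
  have hlow : ∀ᶠ n : ℕ in atTop, 1 - ENNReal.ofReal (4 / n) ≤ μ n (good n) := by
    filter_upwards [eventually_sq_le_log hd hk ho (8 * ((v : ℝ) + 1)),
      eventually_mul_le hd hk ho, eventually_ge_atTop 1] with n hn hdm hn1
    have hv : (0 : ℝ) ≤ v := v.2
    have hk2 : (2 : ℝ) ≤ ((m n + m n : ℕ) : ℝ) := by exact_mod_cast hk n
    have hd1 : (1 : ℝ) ≤ d n := by exact_mod_cast hd n
    have hk8 : 8 * ((v : ℝ) + 1) * ((m n + m n : ℕ) : ℝ) ≤ Real.log n := by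
      refine le_trans ?_ hn
      gcongr
      nlinarith
    have hklog : ((m n + m n : ℕ) : ℝ) ≤ Real.log n := by nlinarith
    have hlog : 1 ≤ Real.log n := by linarith
    have hbad := measure_prod_blockThreshold_lt_opNorm_le (hT n) hlog (hm n) (hd n) hdm hk8
    have hsub : (good n)ᶜ ⊆ {ω | ∏ j, blockThreshold n (m n) (d n) j <
        opNorm (certificate (flatten (asymmetrize (T n ω))) (d n))} := by
      intro ω hω
      by_contra hcon
      refine hω ?_
      have hle : opNorm (certificate (flatten (asymmetrize (T n ω))) (d n)) ≤
          mainBound n (m n) (d n) ^ d n :=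
        (not_lt.1 hcon).trans (prod_blockThreshold_le hlog (hm n) (hd n) hklog)
      have hb0 : 0 ≤ mainBound n (m n) (d n) := by unfold mainBound; positivity
      show opNorm _ ^ (1 / (d n : ℝ)) ≤ _
      calc opNorm (certificate (flatten (asymmetrize (T n ω))) (d n)) ^ (1 / (d n : ℝ))
          ≤ (mainBound n (m n) (d n) ^ d n) ^ (1 / (d n : ℝ)) :=
            Real.rpow_le_rpow (norm_nonneg _) hle (by positivity)
        _ = mainBound n (m n) (d n) := by
            rw [one_div, Real.pow_rpow_inv_natCast hb0 (by have := hd n; omega)]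
        _ ≤ _ := by
            rw [mainBound]
            refine mul_le_mul_of_nonneg_right (le_mul_of_one_le_right (by positivity) ?_)
              (by positivity)
            refine Real.one_le_rpow hd1 (div_nonneg (mul_nonneg (sq_nonneg _) ?_) (by linarith))
            exact Real.log_nonneg hd1
    rw [tsub_le_iff_right, ← measure_univ (μ := μ n), ← Set.union_compl_self (good n)]
    exact (measure_union_le _ _).trans (by gcongr; exact (measure_mono hsub).trans hbad)
  refine tendsto_of_tendsto_of_tendsto_of_le_of_le' ?_ tendsto_const_nhds hlow
    (Eventually.of_forall fun n => prob_le_one)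
  have h4 : Tendsto (fun n : ℕ => ENNReal.ofReal (4 / n)) atTop (𝓝 0) := by
    rw [← ENNReal.ofReal_zero]
    exact (ENNReal.continuous_ofReal.tendsto 0).comp (tendsto_const_div_atTop_nhds_zero_nat 4)
  simpa using ENNReal.Tendsto.sub tendsto_const_nhds h4 (Or.inl ENNReal.one_ne_top)
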